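/- **Setting.** Let $d\ge 2$, let $\Omega\subset\mathbb{R}^d$ be a polytope, i.e. a nonempty connected set that is the interior of a finite union of closed $d$-simplices, let $\varrho>0$, and let $k,l\ge 0$ be integers with $|k-l|\le 1$. A polytopal mesh $(\mathcal{T},\mathcal{F})$ of $\Omega$ consists of a finite set $\mathcal{T}$ of pairwise disjoint polytopes (elements) with $\overline{\Omega}=\bigcup_{T\in\mathcal{T}}\overline{T}$, and a finite set $\mathcal{F}$ of pairwise disjoint faces, each a nonempty connected relatively open subset of a hyperplane whose relative boundary has zero $(d-1)$-dimensional measure. Each face is contained in $\partial T_1\cap\partial T_2$ for two distinct elements $T_1,T_2$, or in $\partial T\cap\partial\Omega$ for some element $T$. For each $T\in\mathcal{T}$, put $\mathcal{F}_T=\{F\in\mathcal{F}: F\subset\partial T\}$; then $\partial T=\bigcup_{F\in\mathcal{F}_T}\overline{F}$, and every $F\in\mathcal{F}_T$ has a constant unit normal $n_{TF}$ pointing outside $T$. Let $h_X$ denote the diameter of $X$. A set $X$ (element or face) is *connected by star-shaped sets with parameter $\varrho$* if it is a union of at most $\varrho^{-1}$ sets $X_i$, each star-shaped with respect to all the points of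 a ball of radius $\varrho h_{X_i}$, such that any two of the $X_i$ are linked by a path of sets $X_j$ in which any two consecutive sets have an intersection containing a ball of radius $\varrho h_X$ (balls being taken in the affine span of $X$). The mesh is *$\varrho$-regular* if all its elements and all its faces are connected by star-shaped sets with parameter $\varrho$. Let $T\in\mathcal{T}$, let $K_T$ be a symmetric $d\times d$ real matrix, and let $\underline{K}_T>0$ satisfy $\underline{K}_T\,x\cdot x\le K_Tx\cdot x$ for all $x\in\mathbb{R}^d$. Let $\mathbb{P}^m(X)$ be the polynomials of total degree at most $m$ on $X$, let $(\cdot,\cdot)_X$ be the $L^2(X)$-inner product (with the sum over $F\in\mathcal{F}_T$ if $X=\partial T$), and let $\pi_X^{0,m}$ be the $L^2(X)$-orthogonal projector on $\mathbb{P}^m(X)$. The local unknowns are the pairs $\underline{v}_T=(v_T,v_{\partial T})\in\underline{U}_T^{k,l}$ with $v_T\in\mathbb{P}^l(T)$ and $v_{\partial T}|_F=v_F\in\mathbb{P}^k(F)$ for each $F\in\mathcal{F}_T$. The potential reconstruction $p\,\underline{v}_T\in\mathbb{P}^{k+1}(T)$ is defined by $$(K_T\nabla p\,\underline{v}_T,\nabla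 w)_T=-(v_T,\nabla\cdot(K_T\nabla w))_T+\sum_{F\in\mathcal{F}_T}(v_F,K_T\nabla w\cdot n_{TF})_F\quad\forall w\in\mathbb{P}^{k+1}(T),\qquad (v_T-p\,\underline{v}_T,1)_T=0 .$$ The difference operators are $\delta_T\underline{v}_T=\pi_T^{0,l}(p\,\underline{v}_T-v_T)$ and, on each $F\in\mathcal{F}_T$, $(\delta_{\partial T}\underline{v}_T)|_F=\pi_F^{0,k}(p\,\underline{v}_T-v_F)$. The minimally scaled gradient-based stabilisation and the boundary stabilisation are $$s_T^{\nabla,\min}(\underline{u}_T,\underline{v}_T)=\underline{K}_T\Big[(\nabla\delta_T\underline{u}_T,\nabla\delta_T\underline{v}_T)_T+h_T^{-1}\sum_{F\in\mathcal{F}_T}(\delta_{\partial T}\underline{u}_T,\delta_{\partial T}\underline{v}_T)_F\Big],$$ $$s_T^{\partial}(\underline{u}_T,\underline{v}_T)=h_T^{-1}\sum_{F\in\mathcal{F}_T}(K_Tn_{TF}\cdot n_{TF})\,(\delta_{\partial T}\underline{u}_T-\delta_T\underline{u}_T,\ \delta_{\partial T}\underline{v}_T-\delta_T\underline{v}_T)_F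 .$$ **Proposition.** There is a constant $C>0$, depending only on $\Omega$, $d$, $\varrho$, $k$ and $l$, such that for every $\varrho$-regular polytopal mesh of $\Omega$, every element $T$ of it, every $K_T$ and $\underline{K}_T$ as above, and every $\underline{v}_T\in\underline{U}_T^{k,l}$, $$s_T^{\nabla,\min}(\underline{v}_T,\underline{v}_T)\le C\,s_T^{\partial}(\underline{v}_T,\underline{v}_T).$$ In particular $C$ does not depend on the number or the size of the faces, nor on $K_T$. -/

import Mathlib

open MeasureTheory Metric Set
open scoped Matrix RealInnerProductSpace

noncomputable section

namespace HHO

/-- The ambient Euclidean space `ℝ^d`. -/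
abbrev Space (d : ℕ) : Type := EuclideanSpace ℝ (Fin d)

/-! ### Polytopal meshes -/

/-- A polytope of `ℝ^d`: a nonempty connected set that is the interior of a finite union of
closed `d`-simplices. Such a set is open and bounded. -/
def IsPolytope {d : ℕ} (T : Set (Space d)) : Prop :=
  IsConnected T ∧
    ∃ S : Set (Affine.Simplex ℝ (Space d) d), S.Finite ∧
      T = interior (⋃ s ∈ S, convexHull ℝ (range s.points))

/-- A polytopal face: a nonempty connected subset of a hyperplane of `ℝ^d`, open in that
hyperplane, whose relative boundary (here `closure F \ F`) has zero `(d-1)`-dimensional measure.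
`μHE[d - 1]` is the `(d-1)`-dimensional Hausdorff measure, normalised so as to be the usual
surface measure on hyperplanes. -/
def IsFace {d : ℕ} (F : Set (Space d)) : Prop :=
  IsConnected F ∧
    (∃ (a : Space d) (c : ℝ) (O : Set (Space d)), a ≠ 0 ∧ IsOpen O ∧
      F = O ∩ {x | ⟪a, x⟫ = c}) ∧
    μHE[d - 1] (closure F \ F) = 0

/-- `n` is the constant unit normal to the face `F` that points outside `T`: it has norm one, it is
orthogonal to `F`, and near almost every point of `F` (for the surface measure) the set `T`
is the open half-ball lying on the side of `F` opposite to `n`. -/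
def IsOuterNormal {d : ℕ} (T F : Set (Space d)) (n : Space d) : Prop :=
  ‖n‖ = 1 ∧ (∀ x ∈ F, ∀ y ∈ F, ⟪n, y - x⟫ = 0) ∧
    ∀ᵐ x ∂(μHE[d - 1].restrict F), ∃ ε > 0, ∀ y ∈ ball x ε, y ∈ T ↔ ⟪n, y - x⟫ < 0

open Classical in
/-- The unit normal to `F` pointing outside `T`. -/
def outerNormal {d : ℕ} (T F : Set (Space d)) : Space d :=
  if h : ∃ n, IsOuterNormal T F n then h.choose else 0

/-- A polytopal mesh of `Ω`: a finite partition of `Ω` into polytopal elements, and a finite family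
of pairwise disjoint faces that partitions the mesh skeleton. The element boundaries
are covered face by face (`frontier_eq`); in particular `⋃ ∂T = ⋃ closure F`. -/
structure PolytopalMesh (d : ℕ) (Ω : Set (Space d)) where
  /-- The mesh elements. -/
  elements : Finset (Set (Space d))
  /-- The mesh faces. -/
  faces : Finset (Set (Space d))
  isPolytope_of_mem : ∀ T ∈ elements, IsPolytope T
  disjoint_elements : ∀ T₁ ∈ elements, ∀ T₂ ∈ elements, T₁ ≠ T₂ → Disjoint T₁ T₂
  closure_eq : closure Ω = ⋃ T ∈ elements, closure T
  isFace_of_mem : ∀ F ∈ faces, IsFace F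
  disjoint_faces : ∀ F₁ ∈ faces, ∀ F₂ ∈ faces, F₁ ≠ F₂ → Disjoint F₁ F₂
  /-- Every face is an interface between two distinct elements, or a boundary face. -/
  interface_or_boundary : ∀ F ∈ faces,
    (∃ T₁ ∈ elements, ∃ T₂ ∈ elements, T₁ ≠ T₂ ∧ F ⊆ frontier T₁ ∩ frontier T₂) ∨
      (∃ T ∈ elements, F ⊆ frontier T ∩ frontier Ω)
  /-- The boundary of an element is covered by the closures of the faces it contains. -/
  frontier_eq : ∀ T ∈ elements,
    frontier T = ⋃ F ∈ {F | F ∈ faces ∧ F ⊆ frontier T}, closure F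
  /-- Each face of an element has a (constant) unit normal pointing outside the element. -/
  exists_outerNormal : ∀ T ∈ elements, ∀ F ∈ faces, F ⊆ frontier T → ∃ n, IsOuterNormal T F n

open Classical in
/-- The set `𝓕_T` of the faces attached to the element `T`. -/
def PolytopalMesh.facesOf {d : ℕ} {Ω : Set (Space d)} (M : PolytopalMesh d Ω)
    (T : Set (Space d)) : Finset (Set (Space d)) :=
  M.faces.filter fun F => F ⊆ frontier T

/-- `X` is connected by star-shaped sets with parameter `ρ`: it is the union of at most `ρ⁻¹` sets
`Y i`, each star-shaped with respect to all the points of a ball of radius `ρ * diam (Y i)`, and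
any two of them are linked by a path of sets `Y j` in which the intersection of any two
consecutive sets contains a ball of radius `ρ * diam X`. The balls are those of the affine span
of `X`: the whole space if `X` is an element, a hyperplane if `X` is a face. -/
def ConnectedByStarShaped {d : ℕ} (ρ : ℝ) (X : Set (Space d)) : Prop :=
  ∃ (N : ℕ) (Y : Fin N → Set (Space d)), (N : ℝ) ≤ ρ⁻¹ ∧ X = ⋃ i, Y i ∧
    (∀ i, ∃ c ∈ affineSpan ℝ X, ∀ z ∈ ball c (ρ * diam (Y i)) ∩ affineSpan ℝ X,
      z ∈ Y i ∧ StarConvex ℝ z (Y i)) ∧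
    ∀ i j, Relation.ReflTransGen
      (fun a b => ∃ c ∈ affineSpan ℝ X,
        ball c (ρ * diam X) ∩ affineSpan ℝ X ⊆ Y a ∩ Y b) i j

/-- The regularity assumption on meshes, with parameter `ρ`. -/
def PolytopalMesh.IsRegular {d : ℕ} {Ω : Set (Space d)} (M : PolytopalMesh d Ω) (ρ : ℝ) : Prop :=
  (∀ T ∈ M.elements, ConnectedByStarShaped ρ T) ∧ ∀ F ∈ M.faces, ConnectedByStarShaped ρ F

/-! ### Polynomials -/

/-- Polynomials in `d` variables of total degree at most `m`. Their restrictions to an element `T`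
form `ℙ^m(T)`, and their restrictions to a face `F` form `ℙ^m(F)`. -/
abbrev Poly (d m : ℕ) : Type := MvPolynomial.restrictTotalDegree (Fin d) ℝ m

/-- The value of a polynomial at a point. -/
def ev {d : ℕ} (p : MvPolynomial (Fin d) ℝ) (x : Space d) : ℝ :=
  MvPolynomial.eval (fun i => x i) p

/-- The gradient of a polynomial at a point. -/
def grad {d : ℕ} (p : MvPolynomial (Fin d) ℝ) (x : Space d) : Fin d → ℝ :=
  fun i => ev (MvPolynomial.pderiv i p) x

/-- The polynomial `∇ · (K ∇ p)`, for a constant matrix `K`. -/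
def divGrad {d : ℕ} (K : Matrix (Fin d) (Fin d) ℝ) (p : MvPolynomial (Fin d) ℝ) :
    MvPolynomial (Fin d) ℝ :=
  ∑ i, MvPolynomial.pderiv i (∑ j, MvPolynomial.C (K i j) * MvPolynomial.pderiv j p)

/-- `q` is the `L²(μ)`-orthogonal projection of `f` on polynomials of degree at most `m`. -/
def IsL2Proj {d : ℕ} (μ : Measure (Space d)) (m : ℕ) (f : Space d → ℝ) (q : Poly d m) : Prop :=
  ∀ w : Poly d m, ∫ x, ev q.1 x * ev w.1 x ∂μ = ∫ x, f x * ev w.1 x ∂μ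

open Classical in
/-- The `L²(μ)`-orthogonal projection of `f` on polynomials of degree at most `m`. For `μ` the
Lebesgue measure on `T` this is `π_T^{0,m}`, for `μ` the surface measure on a face `F`
this is `π_F^{0,m}` (where only the restriction to `F` of the result is meaningful). -/
def l2Proj {d : ℕ} (μ : Measure (Space d)) (m : ℕ) (f : Space d → ℝ) : Poly d m :=
  if h : ∃ q, IsL2Proj μ m f q then h.choose else 0

/-! ### Local unknowns, reconstruction and stabilisation

Here `T` is an element and `𝓕` is the set of its faces. The integral on `∂T` of a piecewise
defined function is the sum of its integrals over the faces. -/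

/-- The local space of unknowns `ℙ^l(T) × ℙ^k(𝓕)`: a polynomial in the element, and a polynomial on
each face. -/
abbrev LocalSpace (d k l : ℕ) (𝓕 : Finset (Set (Space d))) : Type :=
  Poly d l × (𝓕 → Poly d k)

/-- The relations that define the potential reconstruction `p ∈ ℙ^{k+1}(T)` of the unknown `v`. -/
def IsReconstruction {d k l : ℕ} (T : Set (Space d)) (𝓕 : Finset (Set (Space d)))
    (K : Matrix (Fin d) (Fin d) ℝ) (v : LocalSpace d k l 𝓕) (p : Poly d (k + 1)) : Prop :=
  (∀ w : Poly d (k + 1),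
    ∫ x in T, (K *ᵥ grad p.1 x) ⬝ᵥ grad w.1 x =
      -(∫ x in T, ev v.1.1 x * ev (divGrad K w.1) x) +
        ∑ F : 𝓕, ∫ x in F.1, ev (v.2 F).1 x *
          ((K *ᵥ grad w.1 x) ⬝ᵥ (fun i => outerNormal T F.1 i)) ∂μHE[d - 1]) ∧
    ∫ x in T, (ev v.1.1 x - ev p.1 x) = 0

open Classical in
/-- The potential reconstruction `p_{K,T}^{k+1} v`. -/
def reconstruction {d k l : ℕ} (T : Set (Space d)) (𝓕 : Finset (Set (Space d)))
    (K : Matrix (Fin d) (Fin d) ℝ) (v : LocalSpace d k l 𝓕) : Poly d (k + 1) :=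
  if h : ∃ p, IsReconstruction T 𝓕 K v p then h.choose else 0

/-- The element difference operator `δ_{K,T}^l v = π_T^{0,l} (p_{K,T}^{k+1} v - v_T)`. -/
def deltaT {d k l : ℕ} (T : Set (Space d)) (𝓕 : Finset (Set (Space d)))
    (K : Matrix (Fin d) (Fin d) ℝ) (v : LocalSpace d k l 𝓕) : Poly d l :=
  l2Proj (volume.restrict T) l fun x => ev (reconstruction T 𝓕 K v).1 x - ev v.1.1 x

/-- The boundary difference operator `δ_{K,∂T}^k v = π_{∂T}^{0,k} (p_{K,T}^{k+1} v - v_{∂T})`,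
given on each face `F` by `π_F^{0,k} (p_{K,T}^{k+1} v - v_F)`. -/
def deltaBdry {d k l : ℕ} (T : Set (Space d)) (𝓕 : Finset (Set (Space d)))
    (K : Matrix (Fin d) (Fin d) ℝ) (v : LocalSpace d k l 𝓕) (F : 𝓕) : Poly d k :=
  l2Proj (μHE[d - 1].restrict F.1) k fun x => ev (reconstruction T 𝓕 K v).1 x - ev (v.2 F).1 x

/-- The minimally scaled gradient-based stabilisation, where `κ` is the lower bound of the diffusion
tensor on `T`. -/
def sGradMin {d k l : ℕ} (T : Set (Space d)) (𝓕 : Finset (Set (Space d)))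
    (K : Matrix (Fin d) (Fin d) ℝ) (κ : ℝ) (u v : LocalSpace d k l 𝓕) : ℝ :=
  κ * ((∫ x in T, grad (deltaT T 𝓕 K u).1 x ⬝ᵥ grad (deltaT T 𝓕 K v).1 x) +
    (diam T)⁻¹ * ∑ F : 𝓕, ∫ x in F.1,
      ev (deltaBdry T 𝓕 K u F).1 x * ev (deltaBdry T 𝓕 K v F).1 x ∂μHE[d - 1])

/-- The boundary stabilisation. On each face the weight is `K n · n`, with `n` the outer normal. -/
def sBdry {d k l : ℕ} (T : Set (Space d)) (𝓕 : Finset (Set (Space d)))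
    (K : Matrix (Fin d) (Fin d) ℝ) (u v : LocalSpace d k l 𝓕) : ℝ :=
  (diam T)⁻¹ * ∑ F : 𝓕, ∫ x in F.1,
    ((K *ᵥ fun i => outerNormal T F.1 i) ⬝ᵥ fun i => outerNormal T F.1 i) *
      (ev (deltaBdry T 𝓕 K u F).1 x - ev (deltaT T 𝓕 K u).1 x) *
      (ev (deltaBdry T 𝓕 K v F).1 x - ev (deltaT T 𝓕 K v).1 x) ∂μHE[d - 1]

/-! ### The choices made above are meaningful on mesh elements and faces -/

lemma exists_riesz {V : Type*} [AddCommGroup V] [Module ℝ V] [FiniteDimensional ℝ V]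
    (B : V →ₗ[ℝ] V →ₗ[ℝ] ℝ) (φ : V →ₗ[ℝ] ℝ) (h : ∀ w, B w w = 0 → φ w = 0) :
    ∃ p, ∀ w, B p w = φ w := by
  have hmem : φ ∈ LinearMap.range B := by
    have h1 : (LinearMap.range B : Submodule ℝ (Module.Dual ℝ V)).dualCoannihilator.dualAnnihilator
        = LinearMap.range B := Subspace.dualCoannihilator_dualAnnihilator_eq
    rw [← h1, Submodule.mem_dualAnnihilator]
    intro w hw
    rw [Submodule.mem_dualCoannihilator] at hw
    exact h w (hw (B w) ⟨w, rfl⟩)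
  obtain ⟨p, hp⟩ := hmem
  exact ⟨p, fun w => by rw [hp]⟩

lemma continuous_ev {d : ℕ} (p : MvPolynomial (Fin d) ℝ) : Continuous (ev p) := by
  unfold ev
  exact (MvPolynomial.continuous_eval p).comp (by fun_prop)

lemma continuous_grad {d : ℕ} (p : MvPolynomial (Fin d) ℝ) : Continuous (grad p) :=
  continuous_pi fun _ => continuous_ev _

lemma integrableOn_of_continuous {d : ℕ} {ν : Measure (Space d)} {S : Set (Space d)}
    (hb : Bornology.IsBounded S) (hm : MeasurableSet S) (hν : ν S ≠ ⊤) {f : Space d → ℝ}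
    (hf : Continuous f) : IntegrableOn f S ν := by
  obtain ⟨M, hM⟩ := (hb.isCompact_closure.image hf).isBounded.exists_norm_le
  refine Measure.integrableOn_of_bounded (M := M) hν hf.aestronglyMeasurable ?_
  exact ae_restrict_of_forall_mem hm fun x hx => hM _ ⟨x, subset_closure hx, rfl⟩

lemma exists_isL2Proj {d : ℕ} {ν : Measure (Space d)} {S : Set (Space d)}
    (hb : Bornology.IsBounded S) (hm : MeasurableSet S) (hν : ν S ≠ ⊤) (m : ℕ)
    {f : Space d → ℝ} (hf : Continuous f) : ∃ q, IsL2Proj (ν.restrict S) m f q := by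
  have hI : ∀ {g : Space d → ℝ}, Continuous g → Integrable g (ν.restrict S) :=
    fun hg => integrableOn_of_continuous hb hm hν hg
  have hc := fun p : Poly d m => continuous_ev p.1
  let B : Poly d m →ₗ[ℝ] Poly d m →ₗ[ℝ] ℝ := LinearMap.mk₂ ℝ
    (fun q w => ∫ x, ev q.1 x * ev w.1 x ∂(ν.restrict S))
    (fun a b w => by
      rw [← integral_add (hI ((hc a).fun_mul (hc w))) (hI ((hc b).fun_mul (hc w)))]
      simp [ev, add_mul])
    (fun c a w => by
      rw [smul_eq_mul, ← integral_const_mul]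
      simp [ev, MvPolynomial.smul_eval, mul_assoc])
    (fun w a b => by
      rw [← integral_add (hI ((hc w).fun_mul (hc a))) (hI ((hc w).fun_mul (hc b)))]
      simp [ev, mul_add])
    (fun c w a => by
      rw [smul_eq_mul, ← integral_const_mul]
      simp [ev, MvPolynomial.smul_eval, mul_left_comm])
  let φ : Poly d m →ₗ[ℝ] ℝ :=
    { toFun := fun w => ∫ x, f x * ev w.1 x ∂(ν.restrict S)
      map_add' := fun a b => by
        rw [← integral_add (hI (hf.fun_mul (hc a))) (hI (hf.fun_mul (hc b)))]
        simp [ev, mul_add]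
      map_smul' := fun c a => by
        rw [RingHom.id_apply, smul_eq_mul, ← integral_const_mul]
        simp [ev, MvPolynomial.smul_eval, mul_left_comm] }
  obtain ⟨q, hq⟩ := exists_riesz B φ fun w hw => by
    have h0 : ∫ x, ev w.1 x * ev w.1 x ∂(ν.restrict S) = 0 := hw
    rw [integral_eq_zero_iff_of_nonneg (fun x => mul_self_nonneg _)
      (hI ((hc w).fun_mul (hc w)))] at h0
    change ∫ x, f x * ev w.1 x ∂(ν.restrict S) = 0
    refine integral_eq_zero_of_ae ?_
    filter_upwards [h0] with x hx
    have : ev w.1 x = 0 := by simpa using hx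
    simp [this]
  exact ⟨q, hq⟩

lemma eq_zero_of_ev_eq_zero {d : ℕ} {T : Set (Space d)} (ho : IsOpen T) (hne : T.Nonempty)
    (p : MvPolynomial (Fin d) ℝ) (h : ∀ x ∈ T, ev p x = 0) : p = 0 := by
  obtain ⟨a, ha⟩ := hne
  let e := (EuclideanSpace.equiv (Fin d) ℝ).symm
  have hpre : IsOpen (e ⁻¹' T) := ho.preimage e.continuous
  have ha' : e.symm a ∈ e ⁻¹' T := by simpa using ha
  obtain ⟨ε, hε, hball⟩ := Metric.isOpen_iff.1 hpre _ ha'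
  refine MvPolynomial.funext_set (fun i => ball (e.symm a i) ε)
    (fun i => by rw [Real.ball_eq_Ioo]; exact Ioo_infinite (by linarith)) fun x hx => ?_
  have hx' : x ∈ ball (e.symm a) ε := by
    rw [ball_pi _ hε]; exact hx
  have := h _ (hball hx')
  simpa [ev, e] using this

lemma exists_isReconstruction {d k l : ℕ} {T : Set (Space d)} {𝓕 : Finset (Set (Space d))}
    (hb : Bornology.IsBounded T) (ho : IsOpen T) (hne : T.Nonempty)
    (hF : ∀ F ∈ 𝓕, Bornology.IsBounded F ∧ MeasurableSet F ∧ μHE[d - 1] F ≠ ⊤)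
    {K : Matrix (Fin d) (Fin d) ℝ} {κ : ℝ} (hκ : 0 < κ)
    (hK : ∀ x : Fin d → ℝ, κ * (x ⬝ᵥ x) ≤ (K *ᵥ x) ⬝ᵥ x) (v : LocalSpace d k l 𝓕) :
    ∃ p, IsReconstruction T 𝓕 K v p := by
  have hvol : volume T ≠ ⊤ := hb.measure_lt_top.ne
  have hI : ∀ {g : Space d → ℝ}, Continuous g → Integrable g (volume.restrict T) :=
    fun hg => integrableOn_of_continuous hb ho.measurableSet hvol hg
  have hIF : ∀ (F : 𝓕) {g : Space d → ℝ}, Continuous g →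
      Integrable g ((μHE[d - 1]).restrict F.1) := fun F _ hg =>
    integrableOn_of_continuous (hF F.1 F.2).1 (hF F.1 F.2).2.1 (hF F.1 F.2).2.2 hg
  have hc := fun p : MvPolynomial (Fin d) ℝ => continuous_ev p
  have hKg : ∀ p : MvPolynomial (Fin d) ℝ, Continuous fun x => K *ᵥ grad p x := fun p =>
    continuous_const.matrix_mulVec (continuous_grad p)
  have hKgg : ∀ p q : MvPolynomial (Fin d) ℝ,
      Continuous fun x => (K *ᵥ grad p x) ⬝ᵥ grad q x := fun p q =>
    (hKg p).dotProduct (continuous_grad q)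
  have hKn : ∀ (p : MvPolynomial (Fin d) ℝ) (n : Fin d → ℝ),
      Continuous fun x => (K *ᵥ grad p x) ⬝ᵥ n := fun p n =>
    (hKg p).dotProduct continuous_const
  have ga : ∀ (p q : MvPolynomial (Fin d) ℝ) x, grad (p + q) x = grad p x + grad q x := by
    intro p q x; ext i; simp [grad, ev]
  have gs : ∀ (c : ℝ) (p : MvPolynomial (Fin d) ℝ) x, grad (c • p) x = c • grad p x := by
    intro c p x; ext i; simp [grad, ev, MvPolynomial.smul_eval]
  have da : ∀ (p q : MvPolynomial (Fin d) ℝ), divGrad K (p + q) = divGrad K p + divGrad K q := by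
    intro p q; simp [divGrad, mul_add, Finset.sum_add_distrib]
  have ds : ∀ (c : ℝ) (p : MvPolynomial (Fin d) ℝ), divGrad K (c • p) = c • divGrad K p := by
    intro c p; simp [divGrad, Finset.smul_sum]
  have ea : ∀ (p q : MvPolynomial (Fin d) ℝ) x, ev (p + q) x = ev p x + ev q x := by
    intro p q x; simp [ev]
  have es : ∀ (c : ℝ) (p : MvPolynomial (Fin d) ℝ) x, ev (c • p) x = c * ev p x := by
    intro c p x; simp [ev, MvPolynomial.smul_eval]
  let B : Poly d (k + 1) →ₗ[ℝ] Poly d (k + 1) →ₗ[ℝ] ℝ := LinearMap.mk₂ ℝ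
    (fun q w => ∫ x in T, (K *ᵥ grad q.1 x) ⬝ᵥ grad w.1 x)
    (fun a b w => by
      rw [← integral_add (hI (hKgg a w)) (hI (hKgg b w))]
      simp [ga, Matrix.mulVec_add, add_dotProduct])
    (fun c a w => by
      rw [smul_eq_mul, ← integral_const_mul]
      simp [gs, Matrix.mulVec_smul])
    (fun w a b => by
      rw [← integral_add (hI (hKgg w a)) (hI (hKgg w b))]
      simp [ga, dotProduct_add])
    (fun c w a => by
      rw [smul_eq_mul, ← integral_const_mul]
      simp [gs])
  let φ : Poly d (k + 1) →ₗ[ℝ] ℝ :=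
    { toFun := fun w => -(∫ x in T, ev v.1.1 x * ev (divGrad K w.1) x) +
        ∑ F : 𝓕, ∫ x in F.1, ev (v.2 F).1 x *
          ((K *ᵥ grad w.1 x) ⬝ᵥ (fun i => outerNormal T F.1 i)) ∂μHE[d - 1]
      map_add' := fun a b => by
        have h1 : ∫ x in T, ev v.1.1 x * ev (divGrad K (a + b).1) x =
            (∫ x in T, ev v.1.1 x * ev (divGrad K a.1) x) +
              ∫ x in T, ev v.1.1 x * ev (divGrad K b.1) x := by
          rw [← integral_add (hI ((hc _).fun_mul (hc _))) (hI ((hc _).fun_mul (hc _)))]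
          simp [da, ea, mul_add]
        have h2 : ∀ F : 𝓕, ∫ x in F.1, ev (v.2 F).1 x *
            ((K *ᵥ grad (a + b).1 x) ⬝ᵥ (fun i => outerNormal T F.1 i)) ∂μHE[d - 1] =
            (∫ x in F.1, ev (v.2 F).1 x *
            ((K *ᵥ grad a.1 x) ⬝ᵥ (fun i => outerNormal T F.1 i)) ∂μHE[d - 1]) +
            ∫ x in F.1, ev (v.2 F).1 x *
            ((K *ᵥ grad b.1 x) ⬝ᵥ (fun i => outerNormal T F.1 i)) ∂μHE[d - 1] := fun F => by
          rw [← integral_add (hIF F ((hc _).fun_mul (hKn _ _))) (hIF F ((hc _).fun_mul (hKn _ _)))]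
          simp [ga, Matrix.mulVec_add, add_dotProduct, mul_add]
        simp only [h1, h2, Finset.sum_add_distrib]
        ring
      map_smul' := fun c a => by
        have h1 : ∫ x in T, ev v.1.1 x * ev (divGrad K (c • a).1) x =
            c * ∫ x in T, ev v.1.1 x * ev (divGrad K a.1) x := by
          rw [← integral_const_mul]
          simp [ds, es, mul_left_comm]
        have h2 : ∀ F : 𝓕, ∫ x in F.1, ev (v.2 F).1 x *
            ((K *ᵥ grad (c • a).1 x) ⬝ᵥ (fun i => outerNormal T F.1 i)) ∂μHE[d - 1] =
            c * ∫ x in F.1, ev (v.2 F).1 x *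
            ((K *ᵥ grad a.1 x) ⬝ᵥ (fun i => outerNormal T F.1 i)) ∂μHE[d - 1] := fun F => by
          rw [← integral_const_mul]
          simp [gs, Matrix.mulVec_smul, mul_left_comm]
        simp only [h1, h2, ← Finset.mul_sum, RingHom.id_apply, smul_eq_mul]
        ring }
  obtain ⟨q, hq⟩ := exists_riesz B φ fun w hw => by
    have h0 : ∫ x in T, (K *ᵥ grad w.1 x) ⬝ᵥ grad w.1 x = 0 := hw
    have hsq : ∀ x : Fin d → ℝ, 0 ≤ x ⬝ᵥ x := fun x =>
      Finset.sum_nonneg fun i _ => mul_self_nonneg _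
    have hnn : ∀ x : Space d, 0 ≤ (K *ᵥ grad w.1 x) ⬝ᵥ grad w.1 x := fun x =>
      (mul_nonneg hκ.le (hsq _)).trans (hK _)
    rw [integral_eq_zero_iff_of_nonneg hnn (hI (hKgg w w))] at h0
    have h1 : EqOn (fun x => (K *ᵥ grad w.1 x) ⬝ᵥ grad w.1 x) 0 T :=
      Measure.eqOn_open_of_ae_eq h0 ho (hKgg w w).continuousOn continuousOn_const
    have hp : ∀ i, MvPolynomial.pderiv i w.1 = 0 := fun i => by
      refine eq_zero_of_ev_eq_zero ho hne _ fun x hx => ?_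
      have h2 : (K *ᵥ grad w.1 x) ⬝ᵥ grad w.1 x = 0 := h1 hx
      have h3 : grad w.1 x ⬝ᵥ grad w.1 x = 0 := by
        have := hK (grad w.1 x)
        rw [h2] at this
        exact le_antisymm (by nlinarith) (hsq _)
      exact congrFun (dotProduct_self_eq_zero.1 h3) i
    have hg : ∀ x, grad w.1 x = 0 := fun x => by ext i; simp [grad, hp, ev]
    have hd : divGrad K w.1 = 0 := by simp [divGrad, hp]
    change -(∫ x in T, ev v.1.1 x * ev (divGrad K w.1) x) + _ = 0
    simp [hg, hd, ev]
  have hpos : 0 < volume.real T :=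
    ENNReal.toReal_pos (ho.measure_pos volume hne).ne' hvol
  let c : ℝ := (∫ x in T, (ev v.1.1 x - ev q.1 x)) / volume.real T
  refine ⟨q + ⟨MvPolynomial.C c, by
    rw [MvPolynomial.mem_restrictTotalDegree, MvPolynomial.totalDegree_C]; exact Nat.zero_le _⟩,
    fun w => ?_, ?_⟩
  · have h1 : ∀ x, grad (q.1 + MvPolynomial.C c) x = grad q.1 x := fun x => by
      ext i; simp [grad, ev]
    have h2 := hq w
    change ∫ x in T, (K *ᵥ grad (q.1 + MvPolynomial.C c) x) ⬝ᵥ grad w.1 x = _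
    simp only [h1]
    exact h2
  · have h1 : ∀ x, ev (q.1 + MvPolynomial.C c) x = ev q.1 x + c := fun x => by simp [ev]
    change ∫ x in T, (ev v.1.1 x - ev (q.1 + MvPolynomial.C c) x) = 0
    simp only [h1, ← sub_sub]
    rw [integral_sub (hI ((hc _).fun_sub (hc _))) (hI continuous_const)]
    simp [c]
    field_simp
    simp

lemma IsPolytope.isOpen {d : ℕ} {T : Set (Space d)} (hT : IsPolytope T) : IsOpen T := by
  obtain ⟨-, S, -, rfl⟩ := hT
  exact isOpen_interior

lemma IsPolytope.isBounded {d : ℕ} {T : Set (Space d)} (hT : IsPolytope T) :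
    Bornology.IsBounded T := by
  obtain ⟨-, S, hS, rfl⟩ := hT
  refine Bornology.IsBounded.subset ?_ interior_subset
  exact (Bornology.isBounded_biUnion hS).2 fun s _ =>
    isBounded_convexHull.2 (finite_range s.points).isBounded

lemma IsFace.measurableSet {d : ℕ} {F : Set (Space d)} (hF : IsFace F) : MeasurableSet F := by
  obtain ⟨-, ⟨a, c, O, -, hO, rfl⟩, -⟩ := hF
  exact hO.measurableSet.inter
    (isClosed_eq (continuous_const.inner continuous_id) continuous_const).measurableSet

/-- Bounded faces have finite surface measure. -/
lemma IsFace.measure_ne_top {d : ℕ} {F : Set (Space d)} (hF : IsFace F)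
    (hb : Bornology.IsBounded F) : μHE[d - 1] F ≠ ⊤ := by
  obtain ⟨⟨⟨p, hp⟩, -⟩, ⟨a, c, O, ha, -, hFO⟩, -⟩ := hF
  have hd : d = (d - 1) + 1 := by
    rcases d with _ | d
    · exact absurd (Subsingleton.elim a 0) ha
    · rfl
  let W : Submodule ℝ (Space d) := (ℝ ∙ a)ᗮ
  have : Fact (Module.finrank ℝ (Space d) = (d - 1) + 1) := ⟨by simpa using hd⟩
  have hW : Module.finrank ℝ W = d - 1 := Submodule.finrank_orthogonal_span_singleton ha
  let f : W → Space d := fun w => (w : Space d) + p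
  have hf : Isometry f := (isometry_add_right p).comp isometry_subtype_coe
  have hsub : F ⊆ range f := fun x hx => by
    have h1 : ⟪a, x⟫ = c := by rw [hFO] at hx; exact hx.2
    have h2 : ⟪a, p⟫ = c := by rw [hFO] at hp; exact hp.2
    exact ⟨⟨x - p, Submodule.mem_orthogonal_singleton_iff_inner_right.2
      (by rw [inner_sub_right, h1, h2, sub_self])⟩, by simp [f]⟩
  have h3 := hf.euclideanHausdorffMeasure_preimage (d := d - 1) F
  rw [inter_eq_left.2 hsub, ← hW, InnerProductSpace.euclideanHausdorffMeasure_eq_volume] at h3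
  rw [← hW, ← h3]
  obtain ⟨R, hR⟩ := hb.subset_ball p
  refine ne_top_of_le_ne_top (measure_ball_lt_top (x := (0 : W)) (r := R)).ne
    (measure_mono fun w hw => ?_)
  have h4 := hR hw
  rw [mem_ball] at h4 ⊢
  have h5 : f 0 = p := by simp [f]
  rwa [← hf.dist_eq, h5]

lemma PolytopalMesh.mem_facesOf {d : ℕ} {Ω : Set (Space d)} (M : PolytopalMesh d Ω)
    {T F : Set (Space d)} : F ∈ M.facesOf T ↔ F ∈ M.faces ∧ F ⊆ frontier T := by
  classical
  simp [PolytopalMesh.facesOf]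

lemma PolytopalMesh.facesOf_spec {d : ℕ} {Ω : Set (Space d)} (M : PolytopalMesh d Ω)
    {T : Set (Space d)} (hT : T ∈ M.elements) {F : Set (Space d)} (hF : F ∈ M.facesOf T) :
    Bornology.IsBounded F ∧ MeasurableSet F ∧ μHE[d - 1] F ≠ ⊤ := by
  obtain ⟨h1, h2⟩ := M.mem_facesOf.1 hF
  have hb : Bornology.IsBounded F :=
    ((M.isPolytope_of_mem T hT).isBounded.closure).subset (h2.trans frontier_subset_closure)
  exact ⟨hb, (M.isFace_of_mem F h1).measurableSet, (M.isFace_of_mem F h1).measure_ne_top hb⟩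

/-- The outer normal to a face of an element has its defining property. -/
lemma PolytopalMesh.isOuterNormal_outerNormal {d : ℕ} {Ω : Set (Space d)} (M : PolytopalMesh d Ω)
    {T : Set (Space d)} (hT : T ∈ M.elements) {F : Set (Space d)} (hF : F ∈ M.facesOf T) :
    IsOuterNormal T F (outerNormal T F) := by
  obtain ⟨h1, h2⟩ := M.mem_facesOf.1 hF
  have h := M.exists_outerNormal T hT F h1 h2
  unfold outerNormal
  rw [dif_pos h]
  exact h.choose_spec

/-- On mesh elements, the reconstruction satisfies its defining relations. -/
lemma PolytopalMesh.isReconstruction_reconstruction {d k l : ℕ} {Ω : Set (Space d)}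
    (M : PolytopalMesh d Ω) {T : Set (Space d)} (hT : T ∈ M.elements)
    {K : Matrix (Fin d) (Fin d) ℝ} {κ : ℝ} (hκ : 0 < κ)
    (hK : ∀ x : Fin d → ℝ, κ * (x ⬝ᵥ x) ≤ (K *ᵥ x) ⬝ᵥ x) (v : LocalSpace d k l (M.facesOf T)) :
    IsReconstruction T (M.facesOf T) K v (reconstruction T (M.facesOf T) K v) := by
  have hP := M.isPolytope_of_mem T hT
  have h := exists_isReconstruction hP.isBounded hP.isOpen hP.1.nonempty
    (fun F hF => M.facesOf_spec hT hF) hκ hK v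
  unfold reconstruction
  rw [dif_pos h]
  exact h.choose_spec

/-- On mesh elements, `l2Proj` is the orthogonal projection. -/
lemma PolytopalMesh.isL2Proj_element {d : ℕ} {Ω : Set (Space d)} (M : PolytopalMesh d Ω)
    {T : Set (Space d)} (hT : T ∈ M.elements) (m : ℕ) {f : Space d → ℝ} (hf : Continuous f) :
    IsL2Proj (volume.restrict T) m f (l2Proj (volume.restrict T) m f) := by
  have hP := M.isPolytope_of_mem T hT
  have h := exists_isL2Proj (ν := volume) hP.isBounded hP.isOpen.measurableSet
    hP.isBounded.measure_lt_top.ne m hf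
  unfold l2Proj
  rw [dif_pos h]
  exact h.choose_spec

/-- On mesh faces, `l2Proj` is the orthogonal projection. -/
lemma PolytopalMesh.isL2Proj_face {d : ℕ} {Ω : Set (Space d)} (M : PolytopalMesh d Ω)
    {T : Set (Space d)} (hT : T ∈ M.elements) {F : Set (Space d)} (hF : F ∈ M.facesOf T)
    (m : ℕ) {f : Space d → ℝ} (hf : Continuous f) :
    IsL2Proj (μHE[d - 1].restrict F) m f (l2Proj (μHE[d - 1].restrict F) m f) := by
  obtain ⟨h1, h2, h3⟩ := M.facesOf_spec hT hF
  have h := exists_isL2Proj h1 h2 h3 m hf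
  unfold l2Proj
  rw [dif_pos h]
  exact h.choose_spec

end HHO

end

/-!
The face weight `K n · n` is at least the lower bound `κ`, so it suffices to control the element
difference `δ` and the face differences `δ_F` by the jumps `δ_F - δ`, weighted by `K n · n`.

The definition of the potential reconstruction, integrated by parts, says that
`∫_T δ ∇·(K∇w) = ∑_F ∫_F δ_F K∇w·n` for all `w` of degree at most `k + 1`: the degrees of
`∇·(K∇w)` and `K∇w·n` are low enough for the projections to disappear, since `k ≤ l + 1`
(`PolytopalMesh.integral_deltaT_mul_divGrad`). As `l ≤ k + 1`, the choice `w = δ` is allowed, and a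
second integration by parts gives `∫_T K∇δ·∇δ = ∑_F ∫_F (δ - δ_F) K∇δ·n`
(`PolytopalMesh.energy_deltaT_eq`). Young's inequality for the scalar product of `K` and a discrete
trace inequality applied to the polynomial `K∇δ·∇δ` bound this energy by the boundary stabilisation,
and `κ |∇δ|² ≤ K∇δ·∇δ`. Finally `δ_F` is the sum of the jump and of the trace of `δ`, which has zero
mean on `T`, so that the trace inequality and a Poincaré inequality bound this trace by `∇δ`
(`PolytopalMesh.sGradMin_le_mul_sBdry`). The constant involves those of the two inequalities only.

Three tools carry this argument.

* The divergence theorem on a bounded open set with flat faces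
  (`setIntegral_fderiv_eq_sum_faces`) is proved by slicing. Almost every line of direction `e` meets
  the boundary only at interior points of faces transversal to `e`; on such a line the indicator
  function of the set is a sum of step functions (`indicator_eq_sum_signedStep`), and the projection
  of a face along `e` scales its measure by `|n · e|` (`map_volume_obliqueProj`).
* The discrete trace inequality (`exists_sum_integral_faces_le`). An element is a bounded number of
  sets, each star-shaped with respect to a ball. The part of the boundary in the closure of one of
  them is a graph over the directions issuing from the centre of the ball, so that the cones over
  the corresponding parts of the faces are disjoint subsets of the element; the distance from the
  centre to the hyperplane of each such face is at least the radius of the ball. Polar coordinates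
  in a cone (`setLIntegral_openCone`) reduce the inequality to one for polynomials on a segment. The
  number and the size of the faces play no role.
* The Poincaré inequality for polynomials (`exists_integral_element_sq_le`) follows from the
  equivalence of norms on polynomials of bounded degree, as an element lies between two balls of
  comparable radii with the same centre.
-/

noncomputable section

namespace HHO

/-! ### Measures on hyperplanes -/

section Hyperplane

variable {E : Type*} [NormedAddCommGroup E] [InnerProductSpace ℝ E] [FiniteDimensional ℝ E]
  [MeasurableSpace E] [BorelSpace E]

/-- Cartesian coordinates adapted to a unit vector. -/
lemma measurePreserving_orthogonal_add_smul {n : E} (hn : ‖n‖ = 1) :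
    MeasurePreserving (fun p : (ℝ ∙ n)ᗮ × ℝ => (p.1 : E) + p.2 • n) volume volume := by
  have h1 := ((ℝ ∙ n).measurePreserving_measurableEquivProd (0 : E)).symm
  rw [InnerProductSpace.euclideanHausdorffMeasure_eq_volume] at h1
  have h2 : MeasurePreserving (fun p : (ℝ ∙ n)ᗮ × ℝ =>
      ((LinearIsometryEquiv.toSpanUnitSingleton (𝕜 := ℝ) n hn) p.2, p.1)) volume volume :=
    ((LinearIsometryEquiv.toSpanUnitSingleton (𝕜 := ℝ) n hn).measurePreserving.prod
      (MeasurePreserving.id (volume : Measure (ℝ ∙ n)ᗮ))).comp Measure.measurePreserving_swap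
  have h3 := h1.comp h2
  have h4 : (fun p : (ℝ ∙ n)ᗮ × ℝ => (p.1 : E) + p.2 • n) =
      ((ℝ ∙ n).measurableEquivProd (0 : E)).symm ∘ fun p : (ℝ ∙ n)ᗮ × ℝ =>
        ((LinearIsometryEquiv.toSpanUnitSingleton (𝕜 := ℝ) n hn) p.2, p.1) := by
    funext p
    simp [add_comm]
  rwa [h4]

lemma lintegral_eq_lintegral_orthogonal {n : E} (hn : ‖n‖ = 1) {g : E → ENNReal}
    (hg : Measurable g) :
    ∫⁻ x, g x = ∫⁻ y : (ℝ ∙ n)ᗮ, ∫⁻ t : ℝ, g (y + t • n) := by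
  have h := measurePreserving_orthogonal_add_smul hn
  rw [← h.lintegral_comp hg, Measure.volume_eq_prod, lintegral_prod]
  exact (hg.comp h.measurable).aemeasurable

lemma lintegral_eq_lintegral_orthogonal_symm {n : E} (hn : ‖n‖ = 1) {g : E → ENNReal}
    (hg : Measurable g) :
    ∫⁻ x, g x = ∫⁻ t : ℝ, ∫⁻ y : (ℝ ∙ n)ᗮ, g (y + t • n) := by
  have h := measurePreserving_orthogonal_add_smul hn
  rw [← h.lintegral_comp hg, Measure.volume_eq_prod, lintegral_prod_symm]
  exact (hg.comp h.measurable).aemeasurable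

/-- The surface measure of a hyperplane is the volume of its direction, transported by translation
to any of its points `p`. The freedom in the choice of `p` absorbs translations later on. -/
lemma map_volume_orthogonal_add {n p : E} {b : ℝ} (hn : n ≠ 0) (hp : ⟪n, p⟫ = b) :
    (volume : Measure (ℝ ∙ n)ᗮ).map (fun w : (ℝ ∙ n)ᗮ => (w : E) + p) =
      μHE[Module.finrank ℝ E - 1].restrict {x | ⟪n, x⟫ = b} := by
  have hf : Isometry (fun w : (ℝ ∙ n)ᗮ => (w : E) + p) :=
    (isometry_add_right p).comp isometry_subtype_coe
  have hpos : 0 < Module.finrank ℝ E := by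
    have : Nontrivial E := ⟨n, 0, hn⟩
    exact Module.finrank_pos
  have : Fact (Module.finrank ℝ E = (Module.finrank ℝ E - 1) + 1) := ⟨by omega⟩
  have hW : Module.finrank ℝ (ℝ ∙ n)ᗮ = Module.finrank ℝ E - 1 :=
    Submodule.finrank_orthogonal_span_singleton hn
  have hr : range (fun w : (ℝ ∙ n)ᗮ => (w : E) + p) = {x | ⟪n, x⟫ = b} := by
    ext x
    constructor
    · rintro ⟨w, rfl⟩
      have := Submodule.mem_orthogonal_singleton_iff_inner_right.1 w.2
      simp [inner_add_right, this, hp]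
    · intro hx
      exact ⟨⟨x - p, Submodule.mem_orthogonal_singleton_iff_inner_right.2
        (by rw [inner_sub_right, hp, hx, sub_self])⟩, by simp⟩
  rw [← hr, ← hW, ← hf.map_euclideanHausdorffMeasure,
    InnerProductSpace.euclideanHausdorffMeasure_eq_volume]

lemma lintegral_orthogonal_add {n p : E} {b : ℝ} (hn : n ≠ 0) (hp : ⟪n, p⟫ = b)
    {f : E → ENNReal} (hf : Measurable f) :
    ∫⁻ w : (ℝ ∙ n)ᗮ, f (w + p) = ∫⁻ x in {x | ⟪n, x⟫ = b}, f x ∂μHE[Module.finrank ℝ E - 1] := by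
  rw [← map_volume_orthogonal_add hn hp, lintegral_map hf (by fun_prop)]

/-- The point of the hyperplane `{x | ⟪n, x⟫ = b}` on the line of direction `e` through `y`. -/
def obliqueProj (n e : E) (b : ℝ) (y : E) : E := y + ((b - ⟪n, y⟫) / ⟪n, e⟫) • e

omit [FiniteDimensional ℝ E] [MeasurableSpace E] [BorelSpace E] in
@[fun_prop]
lemma continuous_obliqueProj (n e : E) (b : ℝ) : Continuous (obliqueProj n e b) := by
  unfold obliqueProj; fun_prop

/-- The projection parallel to `e` of the hyperplane orthogonal to `n` onto the hyperplane
orthogonal to `e` multiplies surface measures by `|⟪n, e⟫|`. Both sides are the volume of the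
region swept by translating part of the hyperplane by `t • e`, `t ∈ [0, 1]`. -/
lemma map_volume_obliqueProj {n e : E} (hn : ‖n‖ = 1) (he : ‖e‖ = 1) (hne : ⟪n, e⟫ ≠ 0) (b : ℝ) :
    (volume : Measure (ℝ ∙ e)ᗮ).map (fun y : (ℝ ∙ e)ᗮ => obliqueProj n e b y) =
      ENNReal.ofReal |⟪n, e⟫| • μHE[Module.finrank ℝ E - 1].restrict {x | ⟪n, x⟫ = b} := by
  have hn0 : n ≠ 0 := by rintro rfl; simp at hn
  refine Measure.ext_of_lintegral _ fun f hf => ?_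
  rw [lintegral_map hf (by fun_prop), lintegral_smul_measure, smul_eq_mul]
  let τ : E → ℝ := fun x => (⟪n, x⟫ - b) / ⟪n, e⟫
  have hτ : Measurable τ := by
    have : Continuous τ := by fun_prop
    exact this.measurable
  let I : ℝ → ENNReal := (Icc (0:ℝ) 1).indicator 1
  have hI : Measurable I := measurable_one.indicator measurableSet_Icc
  -- `g` is constant in the direction `e` on the region swept by `x + t • e`, `x` in the hyperplane
  let g : E → ENNReal := fun x => f (obliqueProj n e b x) * I (τ x)
  have hg : Measurable g :=
    (hf.comp (continuous_obliqueProj n e b).measurable).mul (hI.comp hτ)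
  have hIint : ∫⁻ t, I t = 1 := by simp [I, lintegral_indicator]
  have h1 : ∫⁻ x, g x = ∫⁻ y : (ℝ ∙ e)ᗮ, f (obliqueProj n e b y) := by
    rw [lintegral_eq_lintegral_orthogonal he hg]
    refine lintegral_congr fun y => ?_
    have h2 : ∀ t : ℝ, g (y + t • e) =
        f (obliqueProj n e b y) * I (t - (b - ⟪n, (y : E)⟫) / ⟪n, e⟫) := fun t => by
      have a1 : obliqueProj n e b (y + t • e) = obliqueProj n e b y := by
        simp only [obliqueProj, inner_add_right, inner_smul_right, add_assoc, ← add_smul]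
        congr 2; field_simp; ring
      have a2 : τ (y + t • e) = t - (b - ⟪n, (y : E)⟫) / ⟪n, e⟫ := by
        simp only [τ, inner_add_right, inner_smul_right]; field_simp; ring
      simp only [g, a1, a2]
    simp_rw [h2]
    rw [lintegral_const_mul _ (by fun_prop),
      lintegral_sub_right_eq_self (μ := volume) I, hIint, mul_one]
  have h2 : ∫⁻ x, g x = ENNReal.ofReal |⟪n, e⟫| *
      ∫⁻ x in {x | ⟪n, x⟫ = b}, f x ∂μHE[Module.finrank ℝ E - 1] := by
    rw [lintegral_eq_lintegral_orthogonal_symm hn hg]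
    have h3 : ∀ s : ℝ, ∫⁻ w : (ℝ ∙ n)ᗮ, g (w + s • n) =
        (∫⁻ x in {x | ⟪n, x⟫ = b}, f x ∂μHE[Module.finrank ℝ E - 1]) *
          I ((s - b) / ⟪n, e⟫) := fun s => by
      -- on the slice `⟪n, x⟫ = s`, the projection along `e` is a translation onto the hyperplane
      have hp : ⟪n, s • n + ((b - s) / ⟪n, e⟫) • e⟫ = b := by
        rw [inner_add_right, inner_smul_right, inner_smul_right, real_inner_self_eq_norm_sq, hn]
        field_simp; ring
      rw [← lintegral_orthogonal_add hn0 hp hf, ← lintegral_mul_const _ (by fun_prop)]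
      refine lintegral_congr fun w => ?_
      have hw : ⟪n, (w : E) + s • n⟫ = s := by
        rw [inner_add_right, Submodule.mem_orthogonal_singleton_iff_inner_right.1 w.2,
          inner_smul_right, real_inner_self_eq_norm_sq, hn]; ring
      simp only [g, τ, obliqueProj, hw, add_assoc]
    simp_rw [h3]
    rw [lintegral_const_mul _ (by fun_prop), mul_comm]
    congr 1
    have h4 : ∀ s, I ((s - b) / ⟪n, e⟫) = (fun u => I (⟪n, e⟫⁻¹ * u)) (s - b) := fun s => by
      simp only [div_eq_inv_mul]
    simp_rw [h4]
    rw [lintegral_sub_right_eq_self (μ := volume) (fun u => I (⟪n, e⟫⁻¹ * u))]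
    have h5 := Real.map_volume_mul_left (inv_ne_zero hne)
    rw [← lintegral_map (μ := volume) hI (by fun_prop : Measurable fun u : ℝ => ⟪n, e⟫⁻¹ * u),
      h5, lintegral_smul_measure, hIint, inv_inv, smul_eq_mul, mul_one]
  rw [← h1, h2]

/-- The open cone of apex `c` over the part `A` of the hyperplane `{x | ⟪n, x⟫ = b}`. -/
def openCone (n c : E) (b : ℝ) (A : Set E) : Set E :=
  {x | ⟪n, x - c⟫ ∈ Ioo 0 (b - ⟪n, c⟫) ∧
    c + ((b - ⟪n, c⟫) / ⟪n, x - c⟫) • (x - c) ∈ A}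

omit [FiniteDimensional ℝ E] in
lemma measurableSet_openCone [SecondCountableTopology E] (n c : E) (b : ℝ)
    {A : Set E} (hA : MeasurableSet A) :
    MeasurableSet (openCone n c b A) := by
  have h1 : Measurable fun x : E => ⟪n, x - c⟫ :=
    (by fun_prop : Continuous fun x : E => ⟪n, x - c⟫).measurable
  refine (h1 measurableSet_Ioo).inter ?_
  exact (measurable_const.add ((measurable_const.div h1).smul (measurable_id.sub_const c))) hA

/-- Integration over a cone in polar form. -/
lemma setLIntegral_openCone {n c : E} {b : ℝ} (hn : ‖n‖ = 1) (hD : 0 < b - ⟪n, c⟫) {A : Set E}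
    (hA : MeasurableSet A) (hAH : A ⊆ {x | ⟪n, x⟫ = b}) {f : E → ENNReal} (hf : Measurable f) :
    ∫⁻ x in openCone n c b A, f x = ENNReal.ofReal (b - ⟪n, c⟫) *
      ∫⁻ s in Ioo (0:ℝ) 1, ENNReal.ofReal (s ^ (Module.finrank ℝ E - 1)) *
        ∫⁻ x in A, f (c + s • (x - c)) ∂μHE[Module.finrank ℝ E - 1] := by
  have hn0 : n ≠ 0 := by rintro rfl; simp at hn
  set D := b - ⟪n, c⟫ with hDdef
  have hcone := measurableSet_openCone n c b hA
  have hpos : 0 < Module.finrank ℝ E := by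
    have : Nontrivial E := ⟨n, 0, hn0⟩
    exact Module.finrank_pos
  have : Fact (Module.finrank ℝ E = (Module.finrank ℝ E - 1) + 1) := ⟨by omega⟩
  have hW : Module.finrank ℝ (ℝ ∙ n)ᗮ = Module.finrank ℝ E - 1 :=
    Submodule.finrank_orthogonal_span_singleton hn0
  rw [← lintegral_indicator hcone, ← lintegral_add_left_eq_self (μ := volume) _ c,
    lintegral_eq_lintegral_orthogonal_symm hn
      (g := fun x => (openCone n c b A).indicator f (c + x))
      ((hf.indicator hcone).comp (measurable_const_add c))]
  let J : ℝ → ENNReal := fun s => ENNReal.ofReal (s ^ (Module.finrank ℝ E - 1)) *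
    ∫⁻ x in A, f (c + s • (x - c)) ∂μHE[Module.finrank ℝ E - 1]
  have key : ∀ τ : ℝ, ∫⁻ w : (ℝ ∙ n)ᗮ, (openCone n c b A).indicator f (c + (w + τ • n)) =
      (Ioo 0 1).indicator J (D⁻¹ * τ) := fun τ => by
    have hin : ∀ w : (ℝ ∙ n)ᗮ, ⟪n, (w : E) + τ • n⟫ = τ := fun w => by
      rw [inner_add_right, Submodule.mem_orthogonal_singleton_iff_inner_right.1 w.2,
        inner_smul_right, real_inner_self_eq_norm_sq, hn]; ring
    by_cases hτ : τ ∈ Ioo 0 D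
    · have hτ0 := hτ.1
      have hs : D⁻¹ * τ ∈ Ioo (0:ℝ) 1 :=
        ⟨by positivity, by rw [inv_mul_lt_iff₀ hD, mul_one]; exact hτ.2⟩
      rw [indicator_of_mem hs]
      have hr : D⁻¹ * τ ≠ 0 := hs.1.ne'
      let h : E → ENNReal := A.indicator fun x => f (c + (D⁻¹ * τ) • (x - c))
      have hh : Measurable h := Measurable.indicator (hf.comp (by fun_prop)) hA
      have e1 : ∀ w : (ℝ ∙ n)ᗮ, (openCone n c b A).indicator f (c + (w + τ • n)) =
          (fun w : (ℝ ∙ n)ᗮ => h (w + (c + D • n))) ((D⁻¹ * τ)⁻¹ • w) := fun w => by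
        have e2 : (c + (D / τ) • ((w : E) + τ • n)) =
            (((D⁻¹ * τ)⁻¹ • w : (ℝ ∙ n)ᗮ) : E) + (c + D • n) := by
          have : (D⁻¹ * τ)⁻¹ = D / τ := by field_simp
          rw [this, smul_add, smul_smul, div_mul_cancel₀ _ hτ0.ne']
          simp only [Submodule.coe_smul]; abel
        have e3 : c + ((w : E) + τ • n) = c + (D⁻¹ * τ) •
            ((((D⁻¹ * τ)⁻¹ • w : (ℝ ∙ n)ᗮ) : E) + (c + D • n) - c) := by
          rw [← e2, add_sub_cancel_left, smul_smul]
          have : D⁻¹ * τ * (D / τ) = 1 := by field_simp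
          rw [this, one_smul]
        have hmem : c + ((w : E) + τ • n) ∈ openCone n c b A ↔
            (((D⁻¹ * τ)⁻¹ • w : (ℝ ∙ n)ᗮ) : E) + (c + D • n) ∈ A := by
          unfold openCone
          rw [mem_ofPred_eq, add_sub_cancel_left, hin, ← hDdef, e2]
          exact and_iff_right hτ
        by_cases hm : c + ((w : E) + τ • n) ∈ openCone n c b A
        · rw [indicator_of_mem hm]
          simp only [h]
          rw [indicator_of_mem (hmem.1 hm), ← e3]
        · rw [indicator_of_notMem hm]
          simp only [h]
          rw [indicator_of_notMem (fun h => hm (hmem.2 h))]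
      have hmeas : Measurable (fun w : (ℝ ∙ n)ᗮ => h (w + (c + D • n))) := hh.comp (by fun_prop)
      simp_rw [e1]
      rw [← lintegral_map (μ := volume) hmeas
        (by fun_prop : Measurable fun w : (ℝ ∙ n)ᗮ => (D⁻¹ * τ)⁻¹ • w),
        Measure.map_addHaar_smul _ (inv_ne_zero hr), lintegral_smul_measure, hW, smul_eq_mul,
        inv_pow, inv_inv, abs_of_pos (pow_pos hs.1 _)]
      have hp : ⟪n, c + D • n⟫ = b := by
        rw [inner_add_right, inner_smul_right, real_inner_self_eq_norm_sq, hn, hDdef]; ring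
      rw [lintegral_orthogonal_add hn0 hp hh, lintegral_indicator hA,
        Measure.restrict_restrict hA, inter_eq_left.2 hAH]
    · have hs : D⁻¹ * τ ∉ Ioo (0:ℝ) 1 := fun hs => hτ
        ⟨by have := mul_pos hD hs.1; rwa [mul_inv_cancel_left₀ hD.ne'] at this,
          by have := hs.2; rwa [inv_mul_lt_iff₀ hD, mul_one] at this⟩
      rw [indicator_of_notMem hs]
      refine (lintegral_congr fun w => indicator_of_notMem (fun hm => hτ ?_) _).trans lintegral_zero
      have := hm.1
      rwa [add_sub_cancel_left, hin] at this
  have hJ : Measurable ((Ioo (0:ℝ) 1).indicator J) := by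
    refine Measurable.indicator ?_ measurableSet_Ioo
    have hfin : SFinite (μHE[Module.finrank ℝ E - 1].restrict A) := by
      have h0 : ⟪n, b • n⟫ = b := by
        rw [inner_smul_right, real_inner_self_eq_norm_sq, hn]; ring
      rw [← inter_eq_left.2 hAH, ← Measure.restrict_restrict hA,
        ← map_volume_orthogonal_add hn0 h0]
      infer_instance
    refine (by fun_prop : Measurable fun s : ℝ =>
      ENNReal.ofReal (s ^ (Module.finrank ℝ E - 1))).mul ?_
    exact Measurable.lintegral_prod_right' (f := fun p : ℝ × E => f (c + p.1 • (p.2 - c)))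
      (hf.comp (by fun_prop))
  simp_rw [key]
  rw [← lintegral_map (μ := volume) hJ (by fun_prop : Measurable fun u : ℝ => D⁻¹ * u),
    Real.map_volume_mul_left (inv_ne_zero hD.ne'), lintegral_smul_measure, inv_inv,
    abs_of_pos hD, smul_eq_mul, lintegral_indicator measurableSet_Ioo]

end Hyperplane

/-! ### Integrals of derivatives on subsets of the line -/

/-- The step function equal to `1` on the left of `a` and to `0` on its right if `0 < s`, and to
`-1` on the left of `a` and `0` on its right otherwise. The value at `a` is `0` in the first case
and `-1` in the second one. -/
def signedStep (s a x : ℝ) : ℝ :=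
  if 0 < s then (if x < a then 1 else 0) else (if x ≤ a then -1 else 0)

lemma signedStep_of_lt {s a x : ℝ} (hs : s ≠ 0) (hx : x < a) :
    signedStep s a x = SignType.sign s := by
  rcases lt_or_gt_of_ne hs with h | h
  · simp [signedStep, not_lt.2 h.le, hx.le, h]
  · simp [signedStep, h, hx]

lemma signedStep_of_gt {s a x : ℝ} (hx : a < x) : signedStep s a x = 0 := by
  simp [signedStep, not_lt.2 hx.le, not_le.2 hx]

lemma eventually_signedStep_eq {s a x : ℝ} (hs : s ≠ 0) (hx : x ≠ a) :
    ∀ᶠ y in nhds x, signedStep s a y = signedStep s a x := by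
  rcases lt_or_gt_of_ne hx with h | h
  · filter_upwards [Iio_mem_nhds h] with y hy
    rw [signedStep_of_lt hs h, signedStep_of_lt hs hy]
  · filter_upwards [Ioi_mem_nhds h] with y hy
    rw [signedStep_of_gt h, signedStep_of_gt hy]

lemma eventually_indicator_sub_signedStep_eq {U : Set ℝ} {s a ε : ℝ} (hs : s ≠ 0) (hε : 0 < ε)
    (h : ∀ u ∈ ball a ε, u ∈ U ↔ s * (u - a) < 0) :
    ∀ᶠ y in nhds a, U.indicator 1 y - signedStep s a y = U.indicator 1 a - signedStep s a a := by
  have ha : U.indicator (1 : ℝ → ℝ) a = 0 :=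
    indicator_of_notMem (fun h' => by simpa using (h a (mem_ball_self hε)).1 h') _
  filter_upwards [ball_mem_nhds a hε] with y hy
  rw [ha]
  have hy' := h y hy
  rcases lt_or_gt_of_ne hs with h0 | h0
  · have e1 : y ∈ U ↔ a < y := by
      rw [hy']
      constructor <;> intro h1 <;> nlinarith
    by_cases hyU : y ∈ U
    · simp [signedStep, not_lt.2 h0.le, indicator, hyU, e1.1 hyU]
    · simp [signedStep, not_lt.2 h0.le, indicator, hyU, not_lt.1 (mt e1.2 hyU)]
  · have e1 : y ∈ U ↔ y < a := by
      rw [hy']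
      constructor <;> intro h1 <;> nlinarith
    by_cases hyU : y ∈ U
    · simp [signedStep, h0, indicator, hyU, e1.1 hyU]
    · simp [signedStep, h0, indicator, hyU, not_lt.1 (mt e1.2 hyU)]

lemma measurable_signedStep (s a : ℝ) : Measurable (signedStep s a) := by
  unfold signedStep
  by_cases h : 0 < s
  · simp only [h, if_true]
    exact Measurable.ite measurableSet_Iio measurable_const measurable_const
  · simp only [h, if_false]
    exact Measurable.ite measurableSet_Iic measurable_const measurable_const

lemma norm_signedStep_le (s a x : ℝ) : ‖signedStep s a x‖ ≤ 1 := by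
  unfold signedStep
  split_ifs <;> simp

/-- A bounded subset of the line whose boundary consists of finitely many points at which it
lies on one known side is a sum of step functions: the difference is locally constant and
vanishes far away. -/
lemma indicator_eq_sum_signedStep {ι : Type*} {J : Finset ι} {t s : ι → ℝ} {U : Set ℝ}
    (hb : Bornology.IsBounded U) (hfr : frontier U ⊆ t '' J) (hinj : InjOn t J)
    (hs : ∀ j ∈ J, s j ≠ 0)
    (hloc : ∀ j ∈ J, ∃ ε > 0, ∀ u ∈ ball (t j) ε, u ∈ U ↔ s j * (u - t j) < 0) (x : ℝ) :
    U.indicator 1 x = ∑ j ∈ J, signedStep (s j) (t j) x := by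
  classical
  have hlc : IsLocallyConstant fun x => U.indicator 1 x - ∑ j ∈ J, signedStep (s j) (t j) x := by
    rw [IsLocallyConstant.iff_eventually_eq]
    intro x
    have hsum : ∀ J' ⊆ J, (∀ j ∈ J', x ≠ t j) → ∀ᶠ y in nhds x,
        ∑ j ∈ J', signedStep (s j) (t j) y = ∑ j ∈ J', signedStep (s j) (t j) x := by
      intro J' hJ' hx
      have := (Filter.eventually_all_finset J').2 fun j hj =>
        eventually_signedStep_eq (hs j (hJ' hj)) (hx j hj)
      filter_upwards [this] with y hy
      exact Finset.sum_congr rfl hy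
    by_cases hx : x ∈ t '' J
    · obtain ⟨j, hj, rfl⟩ := hx
      obtain ⟨ε, hε, h⟩ := hloc j hj
      have hj' : j ∈ J := hj
      filter_upwards [eventually_indicator_sub_signedStep_eq (hs j hj) hε h,
        hsum (J.erase j) (Finset.erase_subset _ _) fun i hi hij =>
          Finset.ne_of_mem_erase hi (hinj (Finset.mem_of_mem_erase hi) hj hij.symm)] with y h1 h2
      rw [← Finset.add_sum_erase J _ hj', ← Finset.add_sum_erase J _ hj', h2]
      linarith
    · have h1 : ∀ᶠ y in nhds x, U.indicator (1 : ℝ → ℝ) y = U.indicator 1 x := by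
        have hxf : x ∉ frontier U := fun h => hx (hfr h)
        rw [frontier_eq_closure_inter_closure] at hxf
        by_cases hxU : x ∈ closure U
        · have h2 : x ∉ closure Uᶜ := fun h => hxf ⟨hxU, h⟩
          have h3 : U ∈ nhds x := by
            rw [closure_compl, notMem_compl_iff] at h2
            exact mem_interior_iff_mem_nhds.1 h2
          filter_upwards [h3] with y hy
          rw [indicator_of_mem hy, indicator_of_mem (mem_of_mem_nhds h3)]; rfl
        · filter_upwards [isClosed_closure.isOpen_compl.mem_nhds hxU] with y hy
          rw [indicator_of_notMem (fun h => hy (subset_closure h)),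
            indicator_of_notMem (fun h => hxU (subset_closure h))]
      filter_upwards [h1, hsum J subset_rfl fun j hj h => hx ⟨j, hj, h.symm⟩] with y h1 h2
      rw [h1, h2]
  obtain ⟨R, hR⟩ := (hb.union (J.finite_toSet.image t).isBounded).subset_ball 0
  have hfar : U.indicator 1 R - ∑ j ∈ J, signedStep (s j) (t j) R = 0 := by
    rw [indicator_of_notMem (fun h => ?_), Finset.sum_eq_zero, sub_zero]
    · intro j hj
      apply signedStep_of_gt
      have := hR (Or.inr ⟨j, hj, rfl⟩)
      rw [mem_ball_zero_iff, Real.norm_eq_abs] at this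
      exact (abs_lt.1 this).2
    · have := hR (Or.inl h)
      rw [mem_ball_zero_iff, Real.norm_eq_abs] at this
      exact absurd (abs_lt.1 this).2 (lt_irrefl _)
  have h0 := hlc.apply_eq_of_preconnectedSpace x R
  exact sub_eq_zero.1 (h0.trans hfar)

lemma setIntegral_Ioc_signedStep_mul_deriv {s a r R : ℝ} (hs : s ≠ 0) (hra : r ≤ a) (haR : a ≤ R)
    {g g' : ℝ → ℝ} (hg : ∀ x, HasDerivAt g (g' x) x) (hg' : Continuous g') :
    ∫ x in Ioc r R, signedStep s a x * g' x = SignType.sign s * (g a - g r) := by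
  have h1 : ∫ x in Ioc r a, g' x = g a - g r := by
    rw [← intervalIntegral.integral_of_le hra]
    exact intervalIntegral.integral_eq_sub_of_hasDerivAt (fun x _ => hg x)
      (hg'.intervalIntegrable _ _)
  have h2 : (Ioc r R ∩ Iic a : Set ℝ) = Ioc r a := by
    rw [← Ioi_inter_Iic, inter_assoc, Iic_inter_Iic, min_eq_right haR, Ioi_inter_Iic]
  have h3 : (fun x => signedStep s a x * g' x) =ᵐ[volume.restrict (Ioc r R)]
      (Iic a).indicator fun x => SignType.sign s * g' x := by
    have : ∀ᵐ x : ℝ ∂(volume.restrict (Ioc r R)), x ≠ a := by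
      refine ae_restrict_of_ae ?_
      simp [ae_iff]
    filter_upwards [this] with x hx
    rcases lt_or_gt_of_ne hx with h | h
    · rw [signedStep_of_lt hs h, indicator_of_mem (mem_Iic.2 h.le)]
    · rw [signedStep_of_gt h, indicator_of_notMem (by simpa using h), zero_mul]
  rw [integral_congr_ae h3, setIntegral_indicator measurableSet_Iic, h2, integral_const_mul, h1]

/-- The fundamental theorem of calculus on a finite union of intervals, described by the side of each
end point on which it lies. -/
lemma setIntegral_deriv_eq_sum_sign {ι : Type*} {J : Finset ι} {t s : ι → ℝ} {U : Set ℝ}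
    (hU : MeasurableSet U)
    (hb : Bornology.IsBounded U) (hfr : frontier U ⊆ t '' J) (hinj : InjOn t J)
    (hs : ∀ j ∈ J, s j ≠ 0)
    (hloc : ∀ j ∈ J, ∃ ε > 0, ∀ u ∈ ball (t j) ε, u ∈ U ↔ s j * (u - t j) < 0)
    {g g' : ℝ → ℝ} (hg : ∀ x, HasDerivAt g (g' x) x) (hg' : Continuous g') :
    ∫ x in U, g' x = ∑ j ∈ J, SignType.sign (s j) * g (t j) := by
  have hind := indicator_eq_sum_signedStep hb hfr hinj hs hloc
  obtain ⟨R, hR⟩ := (hb.union (J.finite_toSet.image t).isBounded).subset_ball 0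
  have htR : ∀ j ∈ J, -R < t j ∧ t j < R := fun j hj => by
    have := hR (Or.inr ⟨j, hj, rfl⟩)
    rwa [mem_ball_zero_iff, Real.norm_eq_abs, abs_lt] at this
  have hUR : ∀ x ∈ U, -R < x ∧ x < R := fun x hx => by
    have := hR (Or.inl hx)
    rwa [mem_ball_zero_iff, Real.norm_eq_abs, abs_lt] at this
  have hsum0 : ∑ j ∈ J, (SignType.sign (s j) : ℝ) = 0 := by
    have h := hind (-R)
    rw [indicator_of_notMem (fun h => (hUR _ h).1.false)] at h
    rw [h]
    exact Finset.sum_congr rfl fun j hj => (signedStep_of_lt (hs j hj) (htR j hj).1).symm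
  have hsub : U ⊆ Ioc (-R) R := fun x hx => ⟨(hUR x hx).1, (hUR x hx).2.le⟩
  have hint : ∀ j ∈ J, IntegrableOn (fun x => signedStep (s j) (t j) x * g' x) (Ioc (-R) R) := by
    intro j _
    have h1 : IntegrableOn g' (Ioc (-R) R) :=
      (hg'.integrableOn_Icc (a := -R) (b := R)).mono_set Ioc_subset_Icc_self
    exact h1.bdd_mul (c := 1) (measurable_signedStep _ _).aestronglyMeasurable
      (Filter.Eventually.of_forall fun x => norm_signedStep_le _ _ x)
  calc ∫ x in U, g' x = ∫ x in Ioc (-R) R, U.indicator 1 x * g' x := by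
        have : (fun x => U.indicator (1 : ℝ → ℝ) x * g' x) = U.indicator g' := by
          funext x; by_cases hx : x ∈ U <;> simp [indicator, hx]
        rw [this, setIntegral_indicator hU, inter_eq_right.2 hsub]
    _ = ∑ j ∈ J, ∫ x in Ioc (-R) R, signedStep (s j) (t j) x * g' x := by
        rw [← integral_finsetSum J hint]
        simp_rw [hind, Finset.sum_mul]
    _ = ∑ j ∈ J, SignType.sign (s j) * (g (t j) - g (-R)) :=
        Finset.sum_congr rfl fun j hj => setIntegral_Ioc_signedStep_mul_deriv (hs j hj)
          (htR j hj).1.le (htR j hj).2.le hg hg'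
    _ = ∑ j ∈ J, SignType.sign (s j) * g (t j) := by
        simp_rw [mul_sub, Finset.sum_sub_distrib, ← Finset.sum_mul, hsum0]; ring

/-! ### The divergence theorem -/

variable {d : ℕ}

/-- A hyperplane parallel to `e` projects to a null set along `e`. -/
lemma volume_orthogonal_inner_eq {n e : Space d} (hn : n ≠ 0) (hne : ⟪n, e⟫ = 0) (b : ℝ) :
    volume {y : (ℝ ∙ e)ᗮ | ⟪n, (y : Space d)⟫ = b} = 0 := by
  by_cases hempty : ∃ y₀ : (ℝ ∙ e)ᗮ, ⟪n, (y₀ : Space d)⟫ = b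
  · obtain ⟨y₀, hy₀⟩ := hempty
    let n' : (ℝ ∙ e)ᗮ := ⟨n, Submodule.mem_orthogonal_singleton_iff_inner_left.2 hne⟩
    have hn' : n' ≠ 0 := fun h => hn (congrArg Subtype.val h)
    let S : AffineSubspace ℝ (ℝ ∙ e)ᗮ := AffineSubspace.mk' y₀ (ℝ ∙ n')ᗮ
    have hS : S ≠ ⊤ := fun h => by
      have h1 : n' + y₀ ∈ S := h ▸ AffineSubspace.mem_top ℝ _ _
      rw [AffineSubspace.mem_mk', vsub_eq_sub, add_sub_cancel_right,
        Submodule.mem_orthogonal_singleton_iff_inner_right] at h1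
      exact hn' (inner_self_eq_zero.1 h1)
    refine measure_mono_null (fun y hy => ?_) (Measure.addHaar_affineSubspace volume S hS)
    change y ∈ AffineSubspace.mk' y₀ (ℝ ∙ n')ᗮ
    rw [AffineSubspace.mem_mk', Submodule.mem_orthogonal_singleton_iff_inner_right]
    have : ⟪n, (y : Space d)⟫ = b := hy
    change ⟪n, (y : Space d) - y₀⟫ = 0
    rw [inner_sub_right, this, hy₀, sub_self]
  · have : {y : (ℝ ∙ e)ᗮ | ⟪n, (y : Space d)⟫ = b} = ∅ :=
      eq_empty_of_forall_notMem fun y hy => hempty ⟨y, hy⟩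
    rw [this, measure_empty]

lemma IsOuterNormal.exists_subset_hyperplane {T F : Set (Space d)} {n : Space d}
    (h : IsOuterNormal T F n) : ∃ b : ℝ, F ⊆ {x | ⟪n, x⟫ = b} := by
  rcases F.eq_empty_or_nonempty with rfl | ⟨x, hx⟩
  · exact ⟨0, empty_subset _⟩
  · refine ⟨⟪n, x⟫, fun y hy => ?_⟩
    have := h.2.1 x hx y hy
    rw [inner_sub_right] at this
    exact sub_eq_zero.1 this

lemma isClosed_hyperplane (n : Space d) (b : ℝ) : IsClosed {x : Space d | ⟪n, x⟫ = b} :=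
  isClosed_eq (by fun_prop) continuous_const

/-- `T` is locally the open half-ball on the side of the hyperplane through `x` opposite to the
vector `n`. -/
def IsHalfBallAt (T : Set (Space d)) (n x : Space d) : Prop :=
  ∃ ε > 0, ∀ y ∈ ball x ε, y ∈ T ↔ ⟪n, y - x⟫ < 0

lemma IsOuterNormal.ae_isHalfBallAt {T F : Set (Space d)} {n : Space d}
    (h : IsOuterNormal T F n) : ∀ᵐ x ∂(μHE[d - 1].restrict F), IsHalfBallAt T n x := h.2.2

/-- Generic lines of direction `e` meet the hyperplane of `F` at most once, and away from the
exceptional points of `F`. -/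
lemma ae_line_generic {T F : Set (Space d)} {n e : Space d} {b : ℝ} (h : IsOuterNormal T F n)
    (hFm : MeasurableSet F) (hF0 : μHE[d - 1] (closure F \ F) = 0) (he : ‖e‖ = 1) :
    ∀ᵐ y : (ℝ ∙ e)ᗮ, (⟪n, e⟫ = 0 → ⟪n, (y : Space d)⟫ ≠ b) ∧
      (⟪n, e⟫ ≠ 0 → obliqueProj n e b y ∈ closure F →
        obliqueProj n e b y ∈ F ∧ IsHalfBallAt T n (obliqueProj n e b y)) := by
  have hn0 : n ≠ 0 := by rintro rfl; simpa using h.1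
  by_cases hne : ⟪n, e⟫ = 0
  · have h1 := volume_orthogonal_inner_eq hn0 hne b
    filter_upwards [measure_eq_zero_iff_ae_notMem.1 h1] with y hy
    exact ⟨fun _ => hy, fun h => absurd hne h⟩
  · have h1 : ∀ᵐ x ∂(μHE[d - 1] : Measure (Space d)), x ∈ closure F →
        x ∈ F ∧ IsHalfBallAt T n x := by
      filter_upwards [measure_eq_zero_iff_ae_notMem.1 hF0,
        (ae_restrict_iff' hFm).1 h.ae_isHalfBallAt] with x hx1 hx2 hx
      have hxF : x ∈ F := by_contra fun h' => hx1 ⟨hx, h'⟩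
      exact ⟨hxF, hx2 hxF⟩
    have h2 := map_volume_obliqueProj h.1 he hne b
    rw [finrank_euclideanSpace_fin] at h2
    have h3 : ∀ᵐ x ∂((volume : Measure (ℝ ∙ e)ᗮ).map fun y : (ℝ ∙ e)ᗮ => obliqueProj n e b y),
        x ∈ closure F → x ∈ F ∧ IsHalfBallAt T n x := by
      rw [h2]
      exact Measure.ae_smul_measure (ae_restrict_of_ae h1) _
    filter_upwards [ae_of_ae_map (by fun_prop) h3] with y hy
    exact ⟨fun h => absurd h hne, fun _ => hy⟩

/-- Integration of a derivative along one line of direction `e`. -/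
lemma setIntegral_line {T : Set (Space d)} {𝓕 : Finset (Set (Space d))}
    {n : Set (Space d) → Space d} {b : Set (Space d) → ℝ} {e y : Space d}
    (hTo : IsOpen T) (hTb : Bornology.IsBounded T) (he : ‖e‖ = 1)
    (hb : ∀ F ∈ 𝓕, F ⊆ {x | ⟪n F, x⟫ = b F})
    (hdisj : ∀ F₁ ∈ 𝓕, ∀ F₂ ∈ 𝓕, F₁ ≠ F₂ → Disjoint F₁ F₂)
    (hfr : frontier T ⊆ ⋃ F ∈ 𝓕, closure F)
    (hy : ∀ F ∈ 𝓕, (⟪n F, e⟫ = 0 → ⟪n F, y⟫ ≠ b F) ∧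
      (⟪n F, e⟫ ≠ 0 → obliqueProj (n F) e (b F) y ∈ closure F →
        obliqueProj (n F) e (b F) y ∈ F ∧ IsHalfBallAt T (n F) (obliqueProj (n F) e (b F) y)))
    {g : Space d → ℝ} (hg : ContDiff ℝ 1 g) :
    ∫ t in {t : ℝ | y + t • e ∈ T}, fderiv ℝ g (y + t • e) e =
      ∑ F ∈ 𝓕, SignType.sign ⟪n F, e⟫ * F.indicator g (obliqueProj (n F) e (b F) y) := by
  classical
  let ℓ : ℝ → Space d := fun t => y + t • e
  have hℓ : Continuous ℓ := by fun_prop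
  let t : Set (Space d) → ℝ := fun F => (b F - ⟪n F, y⟫) / ⟪n F, e⟫
  let J := 𝓕.filter fun F => ⟪n F, e⟫ ≠ 0 ∧ obliqueProj (n F) e (b F) y ∈ F
  have hJ : ∀ F ∈ J, F ∈ 𝓕 ∧ ⟪n F, e⟫ ≠ 0 ∧ obliqueProj (n F) e (b F) y ∈ F := fun F hF =>
    Finset.mem_filter.1 hF
  have hUo : IsOpen (ℓ ⁻¹' T) := hTo.preimage hℓ
  have hUb : Bornology.IsBounded (ℓ ⁻¹' T) := by
    have hanti : AntilipschitzWith 1 ℓ := AntilipschitzWith.of_le_mul_dist fun s u => by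
      simp only [ℓ, dist_add_left, NNReal.coe_one, one_mul]
      rw [dist_eq_norm, dist_eq_norm, ← sub_smul, norm_smul, he, mul_one]
    exact hanti.isBounded_preimage hTb
  have hfrU : frontier (ℓ ⁻¹' T) ⊆ t '' J := by
    intro u hu
    have h1 := hfr (hℓ.frontier_preimage_subset T hu)
    obtain ⟨F, hF, hFu⟩ := mem_iUnion₂.1 h1
    have h2 : ⟪n F, y⟫ + u * ⟪n F, e⟫ = b F := by
      have : ℓ u ∈ {x | ⟪n F, x⟫ = b F} := closure_minimal (hb F hF) (isClosed_hyperplane _ _) hFu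
      simpa [ℓ, inner_add_right, inner_smul_right] using this
    have hne : ⟪n F, e⟫ ≠ 0 := fun h => (hy F hF).1 h (by
      rw [h, mul_zero, add_zero] at h2; exact h2)
    have hut : t F = u := by
      simp only [t]; rw [← h2]; field_simp; ring
    have h3 : obliqueProj (n F) e (b F) y = ℓ u := by
      simp only [obliqueProj, ℓ, ← hut, t]
    refine ⟨F, Finset.mem_coe.2 (Finset.mem_filter.2 ⟨hF, hne, ?_⟩), hut⟩
    exact ((hy F hF).2 hne (h3 ▸ hFu)).1
  have hinj : InjOn t J := by
    intro F hF F' hF' hFF'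
    obtain ⟨h1, -, h2⟩ := hJ F hF
    obtain ⟨h1', -, h2'⟩ := hJ F' hF'
    by_contra hcon
    refine disjoint_left.1 (hdisj F h1 F' h1' hcon) h2 ?_
    have : obliqueProj (n F) e (b F) y = obliqueProj (n F') e (b F') y := by
      simp only [obliqueProj]
      rw [show (b F - ⟪n F, y⟫) / ⟪n F, e⟫ = (b F' - ⟪n F', y⟫) / ⟪n F', e⟫ from hFF']
    rwa [this]
  have hloc : ∀ F ∈ J, ∃ ε > 0, ∀ u ∈ ball (t F) ε, u ∈ ℓ ⁻¹' T ↔ ⟪n F, e⟫ * (u - t F) < 0 := by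
    intro F hF
    obtain ⟨h1, h2, h3⟩ := hJ F hF
    obtain ⟨ε, hε, hball⟩ := ((hy F h1).2 h2 (subset_closure h3)).2
    refine ⟨ε, hε, fun u hu => ?_⟩
    have h4 : ℓ u - obliqueProj (n F) e (b F) y = (u - t F) • e := by
      simp only [ℓ, obliqueProj, t, sub_smul]; abel
    have h5 : ℓ u ∈ ball (obliqueProj (n F) e (b F) y) ε := by
      rw [mem_ball, dist_eq_norm, h4, norm_smul, he, mul_one]
      rwa [mem_ball, dist_eq_norm] at hu
    rw [mem_preimage, hball _ h5, h4, inner_smul_right, mul_comm]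
  have hderiv : ∀ u, HasDerivAt (fun u => g (ℓ u)) (fderiv ℝ g (ℓ u) e) u := fun u => by
    have h1 := (hg.differentiable (by norm_num) (ℓ u)).hasFDerivAt
    have h2 : HasDerivAt ℓ e u := by
      simpa [ℓ] using ((hasDerivAt_id u).smul_const e).const_add y
    exact h1.comp_hasDerivAt u h2
  have hcont : Continuous fun u => fderiv ℝ g (ℓ u) e :=
    ((hg.continuous_fderiv (by norm_num)).comp hℓ).clm_apply continuous_const
  have key := setIntegral_deriv_eq_sum_sign hUo.measurableSet hUb hfrU hinj
    (fun F hF => (hJ F hF).2.1) hloc hderiv hcont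
  change ∫ t in ℓ ⁻¹' T, fderiv ℝ g (ℓ t) e = _
  rw [key, Finset.sum_filter]
  refine Finset.sum_congr rfl fun F _ => ?_
  by_cases hne : ⟪n F, e⟫ = 0
  · simp [hne]
  · by_cases hm : obliqueProj (n F) e (b F) y ∈ F
    · rw [if_pos ⟨hne, hm⟩, indicator_of_mem hm]; rfl
    · rw [if_neg (fun h => hm h.2), indicator_of_notMem hm, mul_zero]

/-- The divergence theorem on a bounded open set whose boundary is covered by finitely many flat
faces with a constant outer normal. -/
theorem setIntegral_fderiv_eq_sum_faces {T : Set (Space d)} {𝓕 : Finset (Set (Space d))}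
    {n : Set (Space d) → Space d}
    (hTo : IsOpen T) (hTb : Bornology.IsBounded T)
    (hn : ∀ F ∈ 𝓕, IsOuterNormal T F (n F))
    (hFb : ∀ F ∈ 𝓕, Bornology.IsBounded F)
    (hFm : ∀ F ∈ 𝓕, MeasurableSet F) (hFfin : ∀ F ∈ 𝓕, μHE[d - 1] F ≠ ⊤)
    (hF0 : ∀ F ∈ 𝓕, μHE[d - 1] (closure F \ F) = 0)
    (hdisj : ∀ F₁ ∈ 𝓕, ∀ F₂ ∈ 𝓕, F₁ ≠ F₂ → Disjoint F₁ F₂)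
    (hfr : frontier T ⊆ ⋃ F ∈ 𝓕, closure F)
    {g : Space d → ℝ} (hg : ContDiff ℝ 1 g) {e : Space d} (he : ‖e‖ = 1) :
    ∫ x in T, fderiv ℝ g x e = ∑ F ∈ 𝓕, ⟪n F, e⟫ * ∫ x in F, g x ∂μHE[d - 1] := by
  classical
  have hex : ∀ F : Set (Space d), ∃ b : ℝ, F ∈ 𝓕 → F ⊆ {x | ⟪n F, x⟫ = b} := fun F => by
    by_cases hF : F ∈ 𝓕
    · obtain ⟨b, hb⟩ := (hn F hF).exists_subset_hyperplane
      exact ⟨b, fun _ => hb⟩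
    · exact ⟨0, fun h => absurd h hF⟩
  choose b hb using hex
  have hgc : Continuous g := hg.continuous
  have hg'c : Continuous fun x => fderiv ℝ g x e :=
    (hg.continuous_fderiv (by norm_num)).clm_apply continuous_const
  have hmp := measurePreserving_orthogonal_add_smul he
  have hint : Integrable (T.indicator fun x => fderiv ℝ g x e) :=
    (integrable_indicator_iff hTo.measurableSet).2
      (integrableOn_of_continuous hTb hTo.measurableSet hTb.measure_lt_top.ne hg'c)
  have hintp : Integrable (fun p : (ℝ ∙ e)ᗮ × ℝ =>
      T.indicator (fun x => fderiv ℝ g x e) ((p.1 : Space d) + p.2 • e))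
      ((volume : Measure (ℝ ∙ e)ᗮ).prod volume) :=
    (hmp.integrable_comp hint.aestronglyMeasurable).2 hint
  have hae : ∀ᵐ y : (ℝ ∙ e)ᗮ, ∀ F ∈ 𝓕, (⟪n F, e⟫ = 0 → ⟪n F, (y : Space d)⟫ ≠ b F) ∧
      (⟪n F, e⟫ ≠ 0 → obliqueProj (n F) e (b F) y ∈ closure F →
        obliqueProj (n F) e (b F) y ∈ F ∧ IsHalfBallAt T (n F) (obliqueProj (n F) e (b F) y)) :=
    (Finset.eventually_all 𝓕).2 fun F hF => ae_line_generic (hn F hF) (hFm F hF) (hF0 F hF) he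
  -- the contribution of one face, by the change of variables along `e`
  have hface : ∀ F ∈ 𝓕,
      Integrable (fun y : (ℝ ∙ e)ᗮ => (SignType.sign ⟪n F, e⟫ : ℝ) *
        F.indicator g (obliqueProj (n F) e (b F) y)) ∧
      ∫ y : (ℝ ∙ e)ᗮ, (SignType.sign ⟪n F, e⟫ : ℝ) * F.indicator g (obliqueProj (n F) e (b F) y) =
        ⟪n F, e⟫ * ∫ x in F, g x ∂μHE[d - 1] := fun F hF => by
    by_cases hne : ⟪n F, e⟫ = 0
    · simp [hne]
    have hmap := map_volume_obliqueProj (hn F hF).1 he hne (b F)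
    rw [finrank_euclideanSpace_fin] at hmap
    have hm : Measurable fun y : (ℝ ∙ e)ᗮ => obliqueProj (n F) e (b F) y := by fun_prop
    have hI : Integrable (F.indicator g) (μHE[d - 1].restrict {x | ⟪n F, x⟫ = b F}) := by
      rw [integrable_indicator_iff (hFm F hF), IntegrableOn, Measure.restrict_restrict (hFm F hF),
        inter_eq_left.2 (hb F hF)]
      exact integrableOn_of_continuous (hFb F hF) (hFm F hF) (hFfin F hF) hgc
    have hI2 : Integrable (F.indicator g)
        ((volume : Measure (ℝ ∙ e)ᗮ).map fun y : (ℝ ∙ e)ᗮ => obliqueProj (n F) e (b F) y) := by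
      rw [hmap]
      exact hI.smul_measure ENNReal.ofReal_ne_top
    refine ⟨(hI2.comp_measurable hm).const_mul _, ?_⟩
    rw [integral_const_mul, ← integral_map hm.aemeasurable hI2.aestronglyMeasurable, hmap,
      integral_smul_measure, ENNReal.toReal_ofReal (abs_nonneg _), integral_indicator (hFm F hF),
      Measure.restrict_restrict (hFm F hF), inter_eq_left.2 (hb F hF), smul_eq_mul, ← mul_assoc,
      sign_mul_abs]
  calc ∫ x in T, fderiv ℝ g x e
      = ∫ y : (ℝ ∙ e)ᗮ, ∫ t : ℝ, T.indicator (fun x => fderiv ℝ g x e) ((y : Space d) + t • e) := by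
        rw [← integral_indicator hTo.measurableSet, ← hmp.map_eq,
          integral_map hmp.measurable.aemeasurable (hmp.map_eq ▸ hint.aestronglyMeasurable),
          Measure.volume_eq_prod, integral_prod _ hintp]
    _ = ∫ y : (ℝ ∙ e)ᗮ, ∑ F ∈ 𝓕, (SignType.sign ⟪n F, e⟫ : ℝ) *
          F.indicator g (obliqueProj (n F) e (b F) y) := by
        refine integral_congr_ae ?_
        filter_upwards [hae] with y hy
        have hm : MeasurableSet {t : ℝ | (y : Space d) + t • e ∈ T} :=
          hTo.measurableSet.preimage
            (by fun_prop : Measurable fun t : ℝ => (y : Space d) + t • e)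
        rw [← setIntegral_line hTo hTb he hb hdisj hfr hy hg, ← integral_indicator hm]
        rfl
    _ = ∑ F ∈ 𝓕, ⟪n F, e⟫ * ∫ x in F, g x ∂μHE[d - 1] := by
        rw [integral_finsetSum _ fun F hF => (hface F hF).1]
        exact Finset.sum_congr rfl fun F hF => (hface F hF).2

/-! ### Equivalence of norms on polynomials -/

/-- On a finite-dimensional space, a positive definite convex homogeneous function dominates
any convex function that is homogeneous of the same degree. -/
lemma exists_le_mul_of_convexOn {V : Type*} [AddCommGroup V] [Module ℝ V] [FiniteDimensional ℝ V]
    {f g : V → ℝ} {k : ℕ} (hk : k ≠ 0) (hf : ConvexOn ℝ univ f) (hg : ConvexOn ℝ univ g)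
    (hfk : ∀ (c : ℝ) v, f (c • v) = |c| ^ k * f v) (hgk : ∀ (c : ℝ) v, g (c • v) = |c| ^ k * g v)
    (hpos : ∀ v, v ≠ 0 → 0 < g v) : ∃ C : ℝ, 0 < C ∧ ∀ v, f v ≤ C * g v := by
  let e := (Module.finBasis ℝ V).equivFun
  have hcont : ∀ h : V → ℝ, ConvexOn ℝ univ h → Continuous fun w => h (e.symm w) := fun h hh =>
    continuousOn_univ.1 ((hh.comp_linearMap e.symm.toLinearMap).continuousOn isOpen_univ)
  have hne : ∀ w ∈ sphere (0 : Fin (Module.finrank ℝ V) → ℝ) 1, g (e.symm w) ≠ 0 := fun w hw => by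
    refine (hpos _ fun h => ?_).ne'
    rw [e.symm.map_eq_zero_iff] at h
    simp [h] at hw
  obtain ⟨C, hC⟩ :=
    (isCompact_sphere (0 : Fin (Module.finrank ℝ V) → ℝ) 1).exists_bound_of_continuousOn
    ((hcont f hf).continuousOn.div (hcont g hg).continuousOn hne)
  refine ⟨max C 1, by positivity, fun v => ?_⟩
  rcases eq_or_ne v 0 with rfl | hv
  · have h1 := hfk 0 0
    have h2 := hgk 0 0
    simp only [smul_zero, abs_zero, zero_pow hk, zero_mul] at h1 h2
    simp [h1, h2]
  · have hw : e v ≠ 0 := fun h => hv (e.map_eq_zero_iff.1 h)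
    have hw' : 0 < ‖e v‖ := norm_pos_iff.2 hw
    let u := ‖e v‖⁻¹ • e v
    have hu : u ∈ sphere (0 : Fin (Module.finrank ℝ V) → ℝ) 1 := by
      rw [mem_sphere_zero_iff_norm]
      simp only [u]
      rw [norm_smul, norm_inv, norm_norm, inv_mul_cancel₀ hw'.ne']
    have hvu : v = ‖e v‖ • e.symm u := by
      simp only [u]
      rw [map_smul, smul_smul, mul_inv_cancel₀ hw'.ne', one_smul, e.symm_apply_apply]
    have hgu : 0 < g (e.symm u) := hpos _ fun h => by
      rw [h, smul_zero] at hvu; exact hv hvu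
    have h1 : f (e.symm u) / g (e.symm u) ≤ max C 1 :=
      (le_abs_self _).trans ((hC u hu).trans (le_max_left C 1))
    rw [div_le_iff₀ hgu] at h1
    rw [hvu, hfk, hgk, ← mul_left_comm]
    exact mul_le_mul_of_nonneg_left h1 (by positivity)

/-- The weight `s ^ D` is the one of polar coordinates. -/
lemma exists_abs_eval_one_le (M D : ℕ) : ∃ C : ℝ, 0 < C ∧ ∀ p : Polynomial ℝ, p.natDegree ≤ M →
    |p.eval 1| ≤ C * ∫ s in Ioo (0:ℝ) 1, s ^ D * |p.eval s| := by
  have hint : ∀ p : Polynomial ℝ, IntegrableOn (fun s => s ^ D * |p.eval s|) (Ioo (0:ℝ) 1) :=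
    fun p => ((by fun_prop : Continuous fun s : ℝ => s ^ D * |p.eval s|).integrableOn_Icc
      (a := 0) (b := 1)).mono_set Ioo_subset_Icc_self
  suffices hV : ∃ C : ℝ, 0 < C ∧ ∀ p : Polynomial.degreeLT ℝ (M + 1),
      |p.1.eval 1| ≤ C * ∫ s in Ioo (0:ℝ) 1, s ^ D * |p.1.eval s| by
    obtain ⟨C, hC, h⟩ := hV
    refine ⟨C, hC, fun p hp => h ⟨p, ?_⟩⟩
    rw [Polynomial.mem_degreeLT]
    exact lt_of_le_of_lt Polynomial.degree_le_natDegree (by exact_mod_cast Nat.lt_succ_of_le hp)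
  refine exists_le_mul_of_convexOn (V := Polynomial.degreeLT ℝ (M + 1)) (k := 1)
    (f := fun p => |p.1.eval 1|) (g := fun p => ∫ s in Ioo (0:ℝ) 1, s ^ D * |p.1.eval s|)
    one_ne_zero ?_ ?_ ?_ ?_ ?_
  · refine ⟨convex_univ, fun p _ q _ a b ha hb _ => ?_⟩
    simp only [Submodule.coe_add, Submodule.coe_smul, Polynomial.eval_add, Polynomial.eval_smul,
      smul_eq_mul]
    refine (abs_add_le _ _).trans (le_of_eq ?_)
    rw [abs_mul, abs_mul, abs_of_nonneg ha, abs_of_nonneg hb]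
  · refine ⟨convex_univ, fun p _ q _ a b ha hb _ => ?_⟩
    simp only [Submodule.coe_add, Submodule.coe_smul, Polynomial.eval_add, Polynomial.eval_smul,
      smul_eq_mul]
    rw [← integral_const_mul, ← integral_const_mul,
      ← integral_add ((hint _).const_mul a) ((hint _).const_mul b)]
    refine setIntegral_mono_on ?_ (((hint _).const_mul a).add ((hint _).const_mul b))
      measurableSet_Ioo fun s hs => ?_
    · simpa using hint (a • p.1 + b • q.1)
    · have hs' : 0 ≤ s ^ D := pow_nonneg hs.1.le D
      calc s ^ D * |a * p.1.eval s + b * q.1.eval s|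
          ≤ s ^ D * (a * |p.1.eval s| + b * |q.1.eval s|) := by
            refine mul_le_mul_of_nonneg_left ((abs_add_le _ _).trans (le_of_eq ?_)) hs'
            rw [abs_mul, abs_mul, abs_of_nonneg ha, abs_of_nonneg hb]
        _ = _ := by ring
  · intro c p
    simp [abs_mul]
  · intro c p
    rw [pow_one, ← integral_const_mul]
    simp [abs_mul, mul_left_comm]
  · intro p hp
    have hnn : ∀ s ∈ Ioo (0:ℝ) 1, 0 ≤ s ^ D * |p.1.eval s| := fun s hs =>
      mul_nonneg (pow_nonneg hs.1.le D) (abs_nonneg _)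
    refine lt_of_le_of_ne (setIntegral_nonneg measurableSet_Ioo hnn) fun h0 => hp ?_
    rw [eq_comm, setIntegral_eq_zero_iff_of_nonneg_ae
      (ae_restrict_of_forall_mem measurableSet_Ioo hnn) (hint _)] at h0
    have h1 : EqOn (fun s => s ^ D * |p.1.eval s|) 0 (Ioo (0:ℝ) 1) :=
      Measure.eqOn_open_of_ae_eq h0 isOpen_Ioo (by fun_prop) continuousOn_const
    refine Subtype.ext (Polynomial.eq_zero_of_infinite_isRoot _
      ((Ioo_infinite (zero_lt_one' ℝ)).mono fun s hs => ?_))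
    have h2 : s ^ D * |p.1.eval s| = 0 := h1 hs
    simpa [(pow_pos hs.1 D).ne'] using h2

/-- A polynomial in `d` variables is controlled at the end point of a segment by its weighted
integral along the segment. -/
lemma exists_ofReal_abs_ev_le (d M D : ℕ) : ∃ C : ℝ, 0 < C ∧
    ∀ q : MvPolynomial (Fin d) ℝ, q.totalDegree ≤ M → ∀ c x : Space d,
      ENNReal.ofReal |ev q x| ≤ ENNReal.ofReal C * ∫⁻ s in Ioo (0:ℝ) 1, ENNReal.ofReal (s ^ D) *
        ENNReal.ofReal |ev q (c + s • (x - c))| := by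
  obtain ⟨C, hC, h⟩ := exists_abs_eval_one_le M D
  refine ⟨C, hC, fun q hq c x => ?_⟩
  let p : Polynomial ℝ := MvPolynomial.aeval
    (fun i => Polynomial.C (c i) + Polynomial.X * Polynomial.C (x i - c i)) q
  have hp : p.natDegree ≤ M := by
    refine (MvPolynomial.aeval_natDegree_le q hq _ (n := 1) fun i => ?_).trans (by simp)
    compute_degree
  have he : ∀ s : ℝ, p.eval s = ev q (c + s • (x - c)) := fun s => by
    simp only [p, ev]
    rw [← Polynomial.coe_aeval_eq_eval, ← AlgHom.comp_apply, MvPolynomial.comp_aeval]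
    simp [MvPolynomial.aeval_eq_eval]
  have h1 := h p hp
  have hint : IntegrableOn (fun s => s ^ D * |p.eval s|) (Ioo (0:ℝ) 1) :=
    ((by fun_prop : Continuous fun s : ℝ => s ^ D * |p.eval s|).integrableOn_Icc
      (a := 0) (b := 1)).mono_set Ioo_subset_Icc_self
  have h2 := ENNReal.ofReal_le_ofReal h1
  rw [ENNReal.ofReal_mul hC.le, ofReal_integral_eq_lintegral_ofReal hint
    (ae_restrict_of_forall_mem measurableSet_Ioo fun s hs =>
      mul_nonneg (pow_nonneg hs.1.le D) (abs_nonneg _)), he, one_smul, add_sub_cancel] at h2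
  refine h2.trans (le_of_eq ?_)
  congr 1
  refine setLIntegral_congr_fun measurableSet_Ioo fun s hs => ?_
  simp only [he]
  rw [ENNReal.ofReal_mul (pow_nonneg hs.1.le D)]

/-! ### Cones in star-shaped sets -/

/-- `Y` contains the ball of centre `c` and radius `r` and is star-shaped with respect to all of its
points. -/
def StarShapedBall (c : Space d) (r : ℝ) (Y : Set (Space d)) : Prop :=
  ∀ z ∈ ball c r, z ∈ Y ∧ StarConvex ℝ z Y

/-- Moving from a point of the closure towards a point of the ball enters the set at once. -/
lemma StarShapedBall.add_smul_sub_mem {c z x : Space d} {r t : ℝ} {Y : Set (Space d)}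
    (hY : StarShapedBall c r Y) (hx : x ∈ closure Y) (hz : z ∈ ball c r) (ht : 0 < t)
    (ht1 : t ≤ 1) : x + t • (z - x) ∈ Y := by
  -- for `y` close to `x`, the point is on the segment from `y` to a point `φ y` of the ball
  let φ : Space d → Space d := fun y => z + ((1 - t) / t) • (x - y)
  have hφ : Continuous φ := by fun_prop
  have hφx : φ x ∈ ball c r := by simpa [φ] using hz
  obtain ⟨y, hy1, hyY⟩ := mem_closure_iff_nhds.1 hx _
    (hφ.continuousAt.preimage_mem_nhds (isOpen_ball.mem_nhds hφx))
  have h1 := (hY (φ y) hy1).2 hyY ht.le (sub_nonneg.2 ht1) (by ring)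
  have h2 : t • φ y + (1 - t) • y = x + t • (z - x) := by
    simp only [φ]
    rw [smul_add, smul_smul, mul_div_cancel₀ _ ht.ne']
    module
  rwa [h2] at h1

/-- At a boundary point of `T` in the closure of a star-shaped part of `T`, the ball lies well
inside the half-space bounded by the face. -/
lemma StarShapedBall.le_inner_sub {c n x : Space d} {r : ℝ} {Y T : Set (Space d)}
    (hY : StarShapedBall c r Y) (hr : 0 < r) (hYT : Y ⊆ T) (hx : x ∈ closure Y) (hn : ‖n‖ = 1)
    (hT : IsHalfBallAt T n x) : r ≤ ⟪n, x⟫ - ⟪n, c⟫ := by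
  obtain ⟨ε, hε, hball⟩ := hT
  have hneg : ∀ z ∈ ball c r, ⟪n, z - x⟫ < 0 := fun z hz => by
    let t := min 1 (ε / (‖z - x‖ + 1))
    have ht : 0 < t := lt_min one_pos (by positivity)
    have hmem := hYT (hY.add_smul_sub_mem hx hz ht (min_le_left _ _))
    have hb : x + t • (z - x) ∈ ball x ε := by
      rw [mem_ball, dist_eq_norm, add_sub_cancel_left, norm_smul, Real.norm_of_nonneg ht.le]
      calc t * ‖z - x‖ ≤ ε / (‖z - x‖ + 1) * ‖z - x‖ :=
            mul_le_mul_of_nonneg_right (min_le_right _ _) (norm_nonneg _)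
        _ < ε := by
            rw [div_mul_eq_mul_div, div_lt_iff₀ (by positivity)]
            nlinarith
    have h1 := (hball _ hb).1 hmem
    rw [add_sub_cancel_left, inner_smul_right] at h1
    by_contra hcon
    exact absurd h1 (not_lt.2 (mul_nonneg ht.le (not_lt.1 hcon)))
  refine le_of_forall_lt fun s hs => ?_
  rcases lt_or_ge s 0 with hs0 | hs0
  · have := hneg c (mem_ball_self hr)
    rw [inner_sub_right] at this
    linarith
  · have hz : c + s • n ∈ ball c r := by
      rw [mem_ball, dist_eq_norm, add_sub_cancel_left, norm_smul, hn, mul_one,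
        Real.norm_of_nonneg hs0]
      exact hs
    have h1 := hneg _ hz
    rw [inner_sub_right, inner_add_right, inner_smul_right, real_inner_self_eq_norm_sq, hn] at h1
    linarith

/-- Points of the open cone lie strictly between the apex and a point of the base. -/
lemma exists_of_mem_openCone {n c p : Space d} {b : ℝ} {A : Set (Space d)}
    (hp : p ∈ openCone n c b A) : ∃ s ∈ Ioo (0:ℝ) 1, ∃ x ∈ A, p = c + s • (x - c) := by
  obtain ⟨h1, h2⟩ := hp
  have hD : 0 < b - ⟪n, c⟫ := h1.1.trans h1.2
  refine ⟨⟪n, p - c⟫ / (b - ⟪n, c⟫), ⟨div_pos h1.1 hD, (div_lt_one hD).2 h1.2⟩, _, h2, ?_⟩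
  rw [add_sub_cancel_left, smul_smul, div_mul_div_cancel₀ hD.ne', div_self h1.1.ne', one_smul,
    add_sub_cancel]

/-- The trace inequality on the part of the boundary seen from a star-shaped part `Y` of `T`:
the cones of apex `c` over the pieces of faces lying in `closure Y` are disjoint subsets of `T`,
and on each ray a polynomial is controlled at the boundary by its integral. -/
lemma StarShapedBall.sum_lintegral_faces_le {T Y : Set (Space d)} {𝓕 : Finset (Set (Space d))}
    {n : Set (Space d) → Space d} {c : Space d} {r C : ℝ}
    (hY : StarShapedBall c r Y) (hr : 0 < r) (hYT : Y ⊆ T) (hTo : IsOpen T)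
    (hn : ∀ F ∈ 𝓕, IsOuterNormal T F (n F)) (hFT : ∀ F ∈ 𝓕, F ⊆ frontier T)
    (hFm : ∀ F ∈ 𝓕, MeasurableSet F) (hFfin : ∀ F ∈ 𝓕, μHE[d - 1] F ≠ ⊤)
    (hdisj : ∀ F₁ ∈ 𝓕, ∀ F₂ ∈ 𝓕, F₁ ≠ F₂ → Disjoint F₁ F₂) {G : Space d → ℝ}
    (hG : Continuous G)
    (hC : ∀ x, ENNReal.ofReal |G x| ≤ ENNReal.ofReal C * ∫⁻ s in Ioo (0:ℝ) 1,
      ENNReal.ofReal (s ^ (d - 1)) * ENNReal.ofReal |G (c + s • (x - c))|) :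
    ENNReal.ofReal r * ∑ F ∈ 𝓕, ∫⁻ x in F ∩ closure Y, ENNReal.ofReal |G x| ∂μHE[d - 1] ≤
      ENNReal.ofReal C * ∫⁻ x in T, ENNReal.ofReal |G x| := by
  classical
  have hex : ∀ F : Set (Space d), ∃ b : ℝ, F ∈ 𝓕 → F ⊆ {x | ⟪n F, x⟫ = b} := fun F => by
    by_cases hF : F ∈ 𝓕
    · obtain ⟨b, hb⟩ := (hn F hF).exists_subset_hyperplane
      exact ⟨b, fun _ => hb⟩
    · exact ⟨0, fun h => absurd h hF⟩
  choose b hb using hex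
  have hGm : Measurable fun x => ENNReal.ofReal |G x| := by fun_prop
  let A : Set (Space d) → Set (Space d) := fun F => F ∩ closure Y
  have hAm : ∀ F ∈ 𝓕, MeasurableSet (A F) := fun F hF =>
    (hFm F hF).inter isClosed_closure.measurableSet
  let cone : Set (Space d) → Set (Space d) := fun F => openCone (n F) c (b F) (A F)
  have hconem : ∀ F ∈ 𝓕, MeasurableSet (cone F) := fun F hF =>
    measurableSet_openCone _ _ _ (hAm F hF)
  have hnot : ∀ F ∈ 𝓕, ∀ x ∈ F, x ∉ T := fun F hF x hx hxT => by
    have h1 := hFT F hF hx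
    rw [hTo.frontier_eq] at h1
    exact h1.2 hxT
  have hin : ∀ x ∈ closure Y, ∀ s : ℝ, 0 ≤ s → s < 1 → c + s • (x - c) ∈ T := by
    intro x hx s hs0 hs
    have h1 := hY.add_smul_sub_mem hx (mem_ball_self hr) (sub_pos.2 hs) (by linarith)
    have h2 : x + (1 - s) • (c - x) = c + s • (x - c) := by module
    rw [h2] at h1
    exact hYT h1
  have hsub : ∀ F, cone F ⊆ T := fun F p hp => by
    obtain ⟨s, hs, x, hx, rfl⟩ := exists_of_mem_openCone hp
    exact hin x hx.2 s hs.1.le hs.2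
  have hcd : (𝓕 : Set (Set (Space d))).PairwiseDisjoint cone := by
    -- two points of the boundary on the same ray from `c` coincide
    have aux : ∀ F ∈ 𝓕, ∀ F' ∈ 𝓕, ∀ s s' : ℝ, ∀ x ∈ A F, ∀ x' ∈ A F', 0 < s → s < s' →
        c + s • (x - c) ≠ c + s' • (x' - c) := by
      intro F hF F' hF' s s' x hx x' hx' hs hss h
      have hs' : 0 < s' := hs.trans hss
      have h1 : x' = c + (s / s') • (x - c) := by
        have h2 : s • (x - c) = s' • (x' - c) := add_left_cancel h
        rw [div_eq_inv_mul, mul_smul, h2, smul_smul, inv_mul_cancel₀ hs'.ne', one_smul,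
          add_sub_cancel]
      refine hnot F' hF' x' hx'.1 ?_
      rw [h1]
      exact hin x hx.2 _ (by positivity) ((div_lt_one hs').2 hss)
    intro F hF F' hF' hne
    refine disjoint_left.2 fun p hp hp' => ?_
    obtain ⟨s, hs, x, hx, rfl⟩ := exists_of_mem_openCone hp
    obtain ⟨s', hs', x', hx', h⟩ := exists_of_mem_openCone hp'
    rcases lt_trichotomy s s' with hss | rfl | hss
    · exact aux F hF F' hF' s s' x hx x' hx' hs.1 hss h
    · have h1 : x = x' := by
        have h2 : s • (x - c) = s • (x' - c) := add_left_cancel h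
        exact sub_left_injective (smul_right_injective _ hs.1.ne' h2)
      subst h1
      exact disjoint_left.1 (hdisj F hF F' hF' hne) hx.1 hx'.1
    · exact aux F' hF' F hF s' s x' hx' x hx hs'.1 hss h.symm
  have hface : ∀ F ∈ 𝓕, ENNReal.ofReal r * ∫⁻ x in A F, ENNReal.ofReal |G x| ∂μHE[d - 1] ≤
      ENNReal.ofReal C * ∫⁻ x in cone F, ENNReal.ofReal |G x| := by
    intro F hF
    by_cases h0 : μHE[d - 1] (A F) = 0
    · rw [Measure.restrict_eq_zero.2 h0]; simp
    have hgood : ∃ x ∈ A F, IsHalfBallAt T (n F) x := by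
      by_contra! hcon
      refine h0 (measure_mono_null (fun x hx => ?_)
        (ae_iff.1 ((ae_restrict_iff' (hFm F hF)).1 (hn F hF).ae_isHalfBallAt)))
      exact fun h => hcon x hx (h hx.1)
    obtain ⟨x₀, hx₀, hx₀T⟩ := hgood
    have hbx : ⟪n F, x₀⟫ = b F := hb F hF hx₀.1
    have hrD : r ≤ b F - ⟪n F, c⟫ := hbx ▸ hY.le_inner_sub hr hYT hx₀.2 (hn F hF).1 hx₀T
    have hcone := setLIntegral_openCone (hn F hF).1 (hr.trans_le hrD) (hAm F hF)
      (inter_subset_left.trans (hb F hF)) hGm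
    rw [finrank_euclideanSpace_fin] at hcone
    have hfin : IsFiniteMeasure (μHE[d - 1].restrict (A F)) :=
      ⟨by rw [Measure.restrict_apply_univ]
          exact (measure_mono inter_subset_left).trans_lt (hFfin F hF).lt_top⟩
    have hGm2 : Measurable fun p : ℝ × Space d => ENNReal.ofReal |G (c + p.1 • (p.2 - c))| := by
      fun_prop
    have hswap : ∫⁻ s in Ioo (0:ℝ) 1, ENNReal.ofReal (s ^ (d - 1)) *
        ∫⁻ x in A F, ENNReal.ofReal |G (c + s • (x - c))| ∂μHE[d - 1] =
        ∫⁻ x in A F, (∫⁻ s in Ioo (0:ℝ) 1, ENNReal.ofReal (s ^ (d - 1)) *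
          ENNReal.ofReal |G (c + s • (x - c))|) ∂μHE[d - 1] := by
      rw [← lintegral_lintegral_swap]
      · refine lintegral_congr fun s => ?_
        rw [lintegral_const_mul]
        fun_prop
      · refine Measurable.aemeasurable ?_
        simp only [Function.uncurry_def]
        fun_prop
    change _ ≤ ENNReal.ofReal C * ∫⁻ x in openCone (n F) c (b F) (A F), ENNReal.ofReal |G x|
    rw [hcone, hswap, mul_left_comm]
    refine mul_le_mul' (ENNReal.ofReal_le_ofReal hrD) ?_
    refine (lintegral_mono hC).trans (le_of_eq (lintegral_const_mul _ ?_))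
    exact Measurable.lintegral_prod_left' (f := fun p : ℝ × Space d =>
      ENNReal.ofReal (p.1 ^ (d - 1)) * ENNReal.ofReal |G (c + p.1 • (p.2 - c))|) (by fun_prop)
  calc ENNReal.ofReal r * ∑ F ∈ 𝓕, ∫⁻ x in F ∩ closure Y, ENNReal.ofReal |G x| ∂μHE[d - 1]
      ≤ ∑ F ∈ 𝓕, ENNReal.ofReal C * ∫⁻ x in cone F, ENNReal.ofReal |G x| := by
        rw [Finset.mul_sum]
        exact Finset.sum_le_sum hface
    _ = ENNReal.ofReal C * ∫⁻ x in ⋃ F ∈ 𝓕, cone F, ENNReal.ofReal |G x| := by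
        rw [lintegral_biUnion_finset hcd hconem, Finset.mul_sum]
    _ ≤ _ := by
        gcongr
        exact iUnion₂_subset fun F _ => hsub F

/-! ### The discrete trace inequality -/

lemma diam_pos_of_isOpen (hd : 0 < d) {T : Set (Space d)} (hTo : IsOpen T) (hne : T.Nonempty)
    (hTb : Bornology.IsBounded T) : 0 < diam T := by
  have : Nonempty (Fin d) := ⟨⟨0, hd⟩⟩
  obtain ⟨x, hx⟩ := hne
  obtain ⟨ε, hε, hball⟩ := Metric.isOpen_iff.1 hTo x hx
  have h1 := diam_mono hball hTb
  rw [diam_ball_eq x hε.le] at h1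
  linarith

/-- The star-shaped parts of an open set have a size comparable to that of the set, so that each
of them contains a ball of comparable radius. -/
lemma ConnectedByStarShaped.exists_starShapedBall (hd : 0 < d) {ρ : ℝ} (hρ : 0 < ρ)
    {T : Set (Space d)} (h : ConnectedByStarShaped ρ T) (hTo : IsOpen T) (hne : T.Nonempty)
    (hTb : Bornology.IsBounded T) :
    ∃ (N : ℕ) (Y : Fin N → Set (Space d)), (N : ℝ) ≤ ρ⁻¹ ∧ 0 < N ∧ T = ⋃ i, Y i ∧
      ∀ i, ∃ c, StarShapedBall c (ρ ^ 2 * diam T) (Y i) := by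
  have : Nonempty (Fin d) := ⟨⟨0, hd⟩⟩
  obtain ⟨N, Y, hN, hT, hstar, hpath⟩ := h
  have hspan : affineSpan ℝ T = ⊤ := hTo.affineSpan_eq_top hne
  have hN0 : 0 < N := by
    obtain ⟨x, hx⟩ := hne
    rw [hT] at hx
    obtain ⟨i, -⟩ := mem_iUnion.1 hx
    exact i.pos
  have hρ1 : ρ ≤ 1 := by
    have h1 : (1 : ℝ) ≤ N := by exact_mod_cast hN0
    have h2 := h1.trans hN
    rwa [one_le_inv₀ hρ] at h2
  have hdT : 0 ≤ diam T := diam_nonneg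
  refine ⟨N, Y, hN, hN0, hT, fun i => ?_⟩
  have hYT : ∀ i, Y i ⊆ T := fun i => hT ▸ subset_iUnion Y i
  have hdiam : ρ * diam T ≤ diam (Y i) := by
    by_cases hi : ∀ j, j = i
    · have hTi : T = Y i := by
        refine Subset.antisymm ?_ (hYT i)
        rw [hT]
        exact iUnion_subset fun j => by rw [hi j]
      rw [← hTi]
      exact mul_le_of_le_one_left hdT hρ1
    · push Not at hi
      obtain ⟨j, hj⟩ := hi
      rcases Relation.ReflTransGen.cases_head (hpath i j) with h1 | ⟨b, ⟨c, -, hc⟩, -⟩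
      · exact absurd h1.symm hj
      · rw [hspan, AffineSubspace.top_coe, inter_univ] at hc
        have h2 := diam_mono (hc.trans inter_subset_left) (hTb.subset (hYT i))
        rw [diam_ball_eq c (by positivity)] at h2
        nlinarith [mul_nonneg hρ.le hdT]
  obtain ⟨c, -, hc⟩ := hstar i
  rw [hspan, AffineSubspace.top_coe, inter_univ] at hc
  refine ⟨c, fun z hz => hc z (ball_subset_ball ?_ hz)⟩
  rw [pow_two, mul_assoc]
  exact mul_le_mul_of_nonneg_left hdiam hρ.le

/-- The discrete trace inequality on the elements of a regular mesh, for polynomials. Its constant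
does not depend on the number or the size of the faces. -/
lemma exists_sum_integral_faces_le (hd : 0 < d) {ρ : ℝ} (hρ : 0 < ρ) (m : ℕ) :
    ∃ C : ℝ, 0 < C ∧ ∀ (Ω : Set (Space d)) (M : PolytopalMesh d Ω), M.IsRegular ρ →
      ∀ T ∈ M.elements, ∀ q : MvPolynomial (Fin d) ℝ, q.totalDegree ≤ m →
        ∑ F ∈ M.facesOf T, ∫ x in F, |ev q x| ∂μHE[d - 1] ≤
          C * (diam T)⁻¹ * ∫ x in T, |ev q x| := by
  obtain ⟨C, hC, h1D⟩ := exists_ofReal_abs_ev_le d m (d - 1)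
  refine ⟨ρ⁻¹ * (C * (ρ ^ 2)⁻¹), by positivity, fun Ω M hM T hT q hq => ?_⟩
  have hP := M.isPolytope_of_mem T hT
  have hTo := hP.isOpen
  have hTb := hP.isBounded
  have hh : 0 < diam T := diam_pos_of_isOpen hd hTo hP.1.nonempty hTb
  obtain ⟨N, Y, hN, hN0, hTY, hY⟩ :=
    (hM.1 T hT).exists_starShapedBall hd hρ hTo hP.1.nonempty hTb
  choose c hc using hY
  have hr : 0 < ρ ^ 2 * diam T := by positivity
  have hqc := continuous_ev q
  have habs : Continuous fun x => |ev q x| := hqc.abs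
  have hFin := fun F (hF : F ∈ M.facesOf T) => M.facesOf_spec hT hF
  have hpiece : ∀ i, ENNReal.ofReal (ρ ^ 2 * diam T) *
      ∑ F ∈ M.facesOf T, ∫⁻ x in F ∩ closure (Y i), ENNReal.ofReal |ev q x| ∂μHE[d - 1] ≤
        ENNReal.ofReal C * ∫⁻ x in T, ENNReal.ofReal |ev q x| := fun i =>
    (hc i).sum_lintegral_faces_le hr (hTY ▸ subset_iUnion Y i) hTo
      (fun F hF => M.isOuterNormal_outerNormal hT hF) (fun F hF => (M.mem_facesOf.1 hF).2)
      (fun F hF => (hFin F hF).2.1) (fun F hF => (hFin F hF).2.2)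
      (fun F hF F' hF' => M.disjoint_faces F (M.mem_facesOf.1 hF).1 F' (M.mem_facesOf.1 hF').1)
      hqc (h1D q hq (c i))
  have hcover : ∀ F ∈ M.facesOf T, ∫⁻ x in F, ENNReal.ofReal |ev q x| ∂μHE[d - 1] ≤
      ∑ i, ∫⁻ x in F ∩ closure (Y i), ENNReal.ofReal |ev q x| ∂μHE[d - 1] := fun F hF => by
    have h1 : F ⊆ ⋃ i, F ∩ closure (Y i) := fun x hx => by
      have h2 := frontier_subset_closure ((M.mem_facesOf.1 hF).2 hx)
      rw [hTY, closure_iUnion_of_finite] at h2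
      obtain ⟨i, hi⟩ := mem_iUnion.1 h2
      exact mem_iUnion.2 ⟨i, hx, hi⟩
    refine (lintegral_mono_set h1).trans ((lintegral_iUnion_le _ _).trans (le_of_eq ?_))
    rw [tsum_fintype]
  have hmain : ENNReal.ofReal (ρ ^ 2 * diam T) *
      ∑ F ∈ M.facesOf T, ∫⁻ x in F, ENNReal.ofReal |ev q x| ∂μHE[d - 1] ≤
        ENNReal.ofReal ρ⁻¹ * (ENNReal.ofReal C * ∫⁻ x in T, ENNReal.ofReal |ev q x|) := by
    calc _ ≤ ENNReal.ofReal (ρ ^ 2 * diam T) * ∑ F ∈ M.facesOf T,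
          ∑ i, ∫⁻ x in F ∩ closure (Y i), ENNReal.ofReal |ev q x| ∂μHE[d - 1] := by
          gcongr with F hF
          exact hcover F hF
      _ = ∑ i, ENNReal.ofReal (ρ ^ 2 * diam T) *
          ∑ F ∈ M.facesOf T, ∫⁻ x in F ∩ closure (Y i), ENNReal.ofReal |ev q x| ∂μHE[d - 1] := by
          rw [Finset.sum_comm, Finset.mul_sum]
      _ ≤ ∑ _i : Fin N, (ENNReal.ofReal C * ∫⁻ x in T, ENNReal.ofReal |ev q x|) :=
          Finset.sum_le_sum fun i _ => hpiece i
      _ = (N : ENNReal) * (ENNReal.ofReal C * ∫⁻ x in T, ENNReal.ofReal |ev q x|) := by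
          simp
      _ ≤ _ := by
          gcongr
          rw [← ENNReal.ofReal_natCast]
          exact ENNReal.ofReal_le_ofReal hN
  -- back to Bochner integrals
  have hiT : Integrable (fun x => |ev q x|) (volume.restrict T) :=
    integrableOn_of_continuous hTb hTo.measurableSet hTb.measure_lt_top.ne habs
  have hconvF : ∀ F ∈ M.facesOf T, ∫⁻ x in F, ENNReal.ofReal |ev q x| ∂μHE[d - 1] =
      ENNReal.ofReal (∫ x in F, |ev q x| ∂μHE[d - 1]) := fun F hF =>
    (ofReal_integral_eq_lintegral_ofReal
      (integrableOn_of_continuous (hFin F hF).1 (hFin F hF).2.1 (hFin F hF).2.2 habs)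
      (Filter.Eventually.of_forall fun x => abs_nonneg _)).symm
  rw [Finset.sum_congr rfl hconvF, ← ENNReal.ofReal_sum_of_nonneg
      fun F _ => integral_nonneg fun x => abs_nonneg _,
    ← ofReal_integral_eq_lintegral_ofReal hiT (Filter.Eventually.of_forall fun x => abs_nonneg _),
    ← ENNReal.ofReal_mul hr.le, ← ENNReal.ofReal_mul hC.le, ← ENNReal.ofReal_mul (by positivity),
    ENNReal.ofReal_le_ofReal_iff (by positivity)] at hmain
  rw [← le_div_iff₀' hr] at hmain
  refine hmain.trans (le_of_eq ?_)
  field_simp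

/-! ### Calculus of polynomials -/

@[simp] lemma ev_add (p q : MvPolynomial (Fin d) ℝ) (x : Space d) :
    ev (p + q) x = ev p x + ev q x := by
  simp [ev]

@[simp] lemma ev_sub (p q : MvPolynomial (Fin d) ℝ) (x : Space d) :
    ev (p - q) x = ev p x - ev q x := by
  simp [ev]

@[simp] lemma ev_mul (p q : MvPolynomial (Fin d) ℝ) (x : Space d) :
    ev (p * q) x = ev p x * ev q x := by
  simp [ev]

@[simp] lemma ev_smul (c : ℝ) (q : MvPolynomial (Fin d) ℝ) (x : Space d) :
    ev (c • q) x = c * ev q x := by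
  simp [ev, MvPolynomial.smul_eval]

@[simp] lemma ev_C (c : ℝ) (x : Space d) : ev (MvPolynomial.C c) x = c := by
  simp [ev]

@[simp] lemma ev_sum {ι : Type*} (s : Finset ι) (p : ι → MvPolynomial (Fin d) ℝ) (x : Space d) :
    ev (∑ i ∈ s, p i) x = ∑ i ∈ s, ev (p i) x := by
  simp [ev]

lemma contDiff_ev (p : MvPolynomial (Fin d) ℝ) : ContDiff ℝ 1 (ev p) := by
  induction p using MvPolynomial.induction_on with
  | C a => simpa [funext (ev_C (d := d) a)] using contDiff_const
  | add p q hp hq => simpa [funext (ev_add p q)] using hp.add hq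
  | mul_X p i hp =>
    have : ev (p * MvPolynomial.X i) = fun x => ev p x * x i := by funext x; simp [ev]
    rw [this]
    exact hp.mul (by fun_prop)

lemma hasFDerivAt_ev (p : MvPolynomial (Fin d) ℝ) (x : Space d) :
    HasFDerivAt (ev p) (∑ i, ev (MvPolynomial.pderiv i p) x •
      (EuclideanSpace.proj i : Space d →L[ℝ] ℝ)) x := by
  classical
  induction p using MvPolynomial.induction_on with
  | C a =>
    have : ev (MvPolynomial.C a) = fun _ : Space d => a := funext (ev_C a)
    rw [this]
    refine (hasFDerivAt_const a x).congr_fderiv ?_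
    simp [ev]
  | add p q hp hq =>
    have : ev (p + q) = fun x : Space d => ev p x + ev q x := funext (ev_add p q)
    rw [this]
    refine (hp.add hq).congr_fderiv ?_
    simp [add_smul, Finset.sum_add_distrib]
  | mul_X p j hp =>
    have : ev (p * MvPolynomial.X j) = fun x => ev p x *
        (EuclideanSpace.proj j : Space d →L[ℝ] ℝ) x := by
      funext x; simp [ev]
    rw [this]
    refine (hp.mul (EuclideanSpace.proj j : Space d →L[ℝ] ℝ).hasFDerivAt).congr_fderiv ?_
    have hX : ev (MvPolynomial.X j) x = x j := by simp [ev]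
    ext v
    simp only [MvPolynomial.pderiv_mul, MvPolynomial.pderiv_X, ev_add, ev_mul, hX, add_smul,
      Finset.sum_add_distrib]
    have h1 : ∀ i, ev (Pi.single (M := fun _ => MvPolynomial (Fin d) ℝ) i 1 j) x =
        if i = j then 1 else 0 := fun i => by
      rcases eq_or_ne i j with rfl | h
      · simp [ev]
      · simp [ev, h]
    simp [h1, Finset.mul_sum, mul_comm, mul_left_comm]
    ring

lemma fderiv_ev_single (p : MvPolynomial (Fin d) ℝ) (x : Space d) (i : Fin d) :
    fderiv ℝ (ev p) x (EuclideanSpace.single i 1) = ev (MvPolynomial.pderiv i p) x := by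
  classical
  rw [(hasFDerivAt_ev p x).fderiv]
  simp

lemma totalDegree_pderiv_le (p : MvPolynomial (Fin d) ℝ) (i : Fin d) :
    (MvPolynomial.pderiv i p).totalDegree ≤ p.totalDegree - 1 := by
  classical
  conv_lhs => rw [p.as_sum, map_sum]
  refine MvPolynomial.totalDegree_finsetSum_le fun s hs => ?_
  rw [MvPolynomial.pderiv_monomial]
  by_cases hsi : s i = 0
  · simp [hsi]
  · refine (MvPolynomial.totalDegree_monomial_le _ _).trans ?_
    have h1 : (s.sum fun _ e => e) ≤ p.totalDegree := MvPolynomial.le_totalDegree hs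
    have h2 : Finsupp.single i 1 ≤ s := by
      rw [Finsupp.single_le_iff]; omega
    have h3 : (s - Finsupp.single i 1).sum (fun _ e => e) + 1 = s.sum fun _ e => e := by
      conv_rhs => rw [← tsub_add_cancel_of_le h2]
      rw [Finsupp.sum_add_index' (by simp) (by simp)]
      simp
    change ((s - Finsupp.single i 1).sum fun _ e => e) ≤ _
    omega

/-- The polynomial `y ↦ q (c + h • y)`. -/
def rescale (c : Space d) (h : ℝ) (q : MvPolynomial (Fin d) ℝ) : MvPolynomial (Fin d) ℝ :=
  MvPolynomial.bind₁ (fun i => MvPolynomial.C (c i) + MvPolynomial.C h * MvPolynomial.X i) q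

lemma ev_rescale (c : Space d) (h : ℝ) (q : MvPolynomial (Fin d) ℝ) (y : Space d) :
    ev (rescale c h q) y = ev q (c + h • y) := by
  simp [ev, rescale, ← MvPolynomial.aeval_eq_eval, MvPolynomial.aeval_bind₁]

lemma totalDegree_rescale_le (c : Space d) (h : ℝ) (q : MvPolynomial (Fin d) ℝ) :
    (rescale c h q).totalDegree ≤ q.totalDegree := by
  unfold rescale
  rw [MvPolynomial.bind₁, MvPolynomial.aeval_def, MvPolynomial.eval₂]
  refine MvPolynomial.totalDegree_finsetSum_le fun s hs => ?_
  have h1 : ∀ i : Fin d, (MvPolynomial.C (c i) + MvPolynomial.C h * MvPolynomial.X i :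
      MvPolynomial (Fin d) ℝ).totalDegree ≤ 1 := fun i => by
    refine (MvPolynomial.totalDegree_add _ _).trans (max_le (by simp) ?_)
    refine (MvPolynomial.totalDegree_mul _ _).trans ?_
    simp
  refine (MvPolynomial.totalDegree_mul _ _).trans ?_
  rw [MvPolynomial.algebraMap_eq, MvPolynomial.totalDegree_C, zero_add]
  refine (MvPolynomial.totalDegree_finsetProd _ _).trans ?_
  refine le_trans (Finset.sum_le_sum fun i _ => ?_) (MvPolynomial.le_totalDegree hs)
  refine (MvPolynomial.totalDegree_pow _ _).trans ?_
  exact (Nat.mul_le_mul_left _ (h1 i)).trans (by simp)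

lemma pderiv_rescale (c : Space d) (h : ℝ) (q : MvPolynomial (Fin d) ℝ) (i : Fin d) :
    MvPolynomial.pderiv i (rescale c h q) = h • rescale c h (MvPolynomial.pderiv i q) := by
  classical
  unfold rescale
  induction q using MvPolynomial.induction_on with
  | C a => simp
  | add p q hp hq => simp [hp, hq]
  | mul_X p j hp =>
    simp only [map_mul, MvPolynomial.bind₁_X_right, MvPolynomial.pderiv_mul, hp, map_add,
      MvPolynomial.pderiv_C, MvPolynomial.pderiv_X, MvPolynomial.smul_eq_C_mul]
    rcases eq_or_ne i j with rfl | hij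
    · simp; ring
    · simp [Pi.single_eq_of_ne' hij]; ring

lemma setIntegral_ball_comp_add_smul (F : Space d → ℝ) (c : Space d) {h : ℝ} (hh : 0 < h) (r : ℝ) :
    ∫ y in ball 0 r, F (c + h • y) = (h ^ d)⁻¹ * ∫ x in ball c (h * r), F x := by
  have h1 := Measure.setIntegral_comp_smul_of_pos (volume : Measure (Space d)) (fun x => F (c + x))
    (ball (0 : Space d) r) hh
  rw [_root_.smul_ball hh.ne', smul_zero, Real.norm_of_nonneg hh.le, finrank_euclideanSpace_fin,
    smul_eq_mul] at h1
  rw [h1]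
  have h2 := (measurePreserving_add_left (volume : Measure (Space d)) c).setIntegral_preimage_emb
    (measurableEmbedding_addLeft c) F (ball c (h * r))
  rw [← h2]
  congr 3
  ext x
  simp [mem_ball, dist_eq_norm]

/-! ### The Poincaré inequality -/

lemma integrableOn_ball {f : Space d → ℝ} (hf : Continuous f) (c : Space d) (r : ℝ) :
    IntegrableOn f (ball c r) :=
  integrableOn_of_continuous isBounded_ball measurableSet_ball measure_ball_lt_top.ne hf

lemma convexOn_sq_linear {V : Type*} [AddCommGroup V] [Module ℝ V] (L : V →ₗ[ℝ] ℝ) :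
    ConvexOn ℝ univ fun v => L v ^ 2 :=
  (even_two.convexOn_pow (𝕜 := ℝ)).comp_linearMap L

lemma convexOn_integral_sq {V : Type*} [AddCommGroup V] [Module ℝ V]
    {L : Space d → V →ₗ[ℝ] ℝ} (hL : ∀ v, Continuous fun x => L x v) (c : Space d) (r : ℝ) :
    ConvexOn ℝ univ fun v => ∫ x in ball c r, L x v ^ 2 := by
  refine ⟨convex_univ, fun v _ w _ a b ha hb hab => ?_⟩
  have hI : ∀ v, IntegrableOn (fun x => L x v ^ 2) (ball c r) := fun v =>
    integrableOn_ball ((hL v).pow 2) c r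
  simp only [smul_eq_mul]
  rw [← integral_const_mul, ← integral_const_mul,
    ← integral_add ((hI v).const_mul a) ((hI w).const_mul b)]
  exact integral_mono (hI _) (((hI v).const_mul a).add ((hI w).const_mul b)) fun x =>
    (convexOn_sq_linear (L x)).2 (mem_univ v) (mem_univ w) ha hb hab

/-- The evaluation of a polynomial obtained linearly from `q`, as a linear form in `q`. -/
def evLinear {m : ℕ} (D : MvPolynomial (Fin d) ℝ →ₗ[ℝ] MvPolynomial (Fin d) ℝ) (x : Space d) :
    Poly d m →ₗ[ℝ] ℝ where
  toFun q := ev (D q.1) x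
  map_add' p q := by simp
  map_smul' c q := by simp

lemma ev_eq_ev_of_pderiv_eq_zero {q : MvPolynomial (Fin d) ℝ}
    (h : ∀ i, MvPolynomial.pderiv i q = 0) (x y : Space d) : ev q x = ev q y := by
  refine is_const_of_fderiv_eq_zero (𝕜 := ℝ) ((contDiff_ev q).differentiable (by norm_num))
    (fun z => ?_) x y
  rw [(hasFDerivAt_ev q z).fderiv]
  simp [h, ev]

/-- A Poincaré inequality for polynomials, between balls of fixed radii: by equivalence of norms
on the finite-dimensional space of polynomials. -/
lemma exists_integral_ball_sq_le (d m : ℕ) (R : ℝ) {s : ℝ} (hs : 0 < s) :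
    ∃ C : ℝ, 0 < C ∧ ∀ q : MvPolynomial (Fin d) ℝ, q.totalDegree ≤ m →
      ∫ x in ball (0 : Space d) R, ev q x ^ 2 ≤
        C * ((∑ i, ∫ x in ball (0 : Space d) s, ev (MvPolynomial.pderiv i q) x ^ 2) +
          ev q (0 : Space d) ^ 2) := by
  suffices hV : ∃ C : ℝ, 0 < C ∧ ∀ q : Poly d m, ∫ x in ball (0 : Space d) R, ev q.1 x ^ 2 ≤
        C * ((∑ i, ∫ x in ball (0 : Space d) s, ev (MvPolynomial.pderiv i q.1) x ^ 2) +
          ev q.1 (0 : Space d) ^ 2) by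
    obtain ⟨C, hC, h⟩ := hV
    exact ⟨C, hC, fun q hq => h ⟨q, (MvPolynomial.mem_restrictTotalDegree _ _ _).2 hq⟩⟩
  have hsum : ∀ (t : Finset (Fin d)), ConvexOn ℝ univ fun q : Poly d m =>
      ∑ i ∈ t, ∫ x in ball (0 : Space d) s, ev (MvPolynomial.pderiv i q.1) x ^ 2 := by
    classical
    intro t
    induction t using Finset.induction_on with
    | empty => simpa using convexOn_const (0 : ℝ) convex_univ
    | insert i t hi ih =>
      simp_rw [Finset.sum_insert hi]
      exact (convexOn_integral_sq (L := fun x => evLinear (MvPolynomial.pderiv i).toLinearMap x)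
        (fun q => continuous_ev _) 0 s).add ih
  refine exists_le_mul_of_convexOn (k := 2) two_ne_zero
    (convexOn_integral_sq (L := fun x => evLinear LinearMap.id x) (fun q => continuous_ev _) 0 R)
    ((hsum Finset.univ).add (convexOn_sq_linear (evLinear LinearMap.id 0))) ?_ ?_ ?_
  · intro c q
    simp [mul_pow, integral_const_mul]
  · intro c q
    simp [mul_pow, integral_const_mul, mul_add, Finset.mul_sum]
  · intro q hq
    have hnn : ∀ i, 0 ≤ ∫ x in ball (0 : Space d) s, ev (MvPolynomial.pderiv i q.1) x ^ 2 :=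
      fun i => integral_nonneg fun x => sq_nonneg _
    have hnn2 := Finset.sum_nonneg fun i (_ : i ∈ Finset.univ) => hnn i
    -- if the right-hand side vanishes, then `q` is a constant, equal to its value `0` at the origin
    refine lt_of_le_of_ne (add_nonneg hnn2 (sq_nonneg _)) fun h0 => hq ?_
    have h0' := (add_eq_zero_iff_of_nonneg hnn2 (sq_nonneg _)).1 h0.symm
    have h1 := (Finset.sum_eq_zero_iff_of_nonneg fun i _ => hnn i).1 h0'.1
    have h2 : ∀ i, MvPolynomial.pderiv i q.1 = 0 := fun i => by
      refine eq_zero_of_ev_eq_zero isOpen_ball ⟨0, mem_ball_self hs⟩ _ fun x hx => ?_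
      have h3 := h1 i (Finset.mem_univ i)
      rw [integral_eq_zero_iff_of_nonneg (fun x => sq_nonneg _)
        (integrableOn_ball ((continuous_ev _).pow 2) _ _)] at h3
      have h4 : EqOn (fun x => ev (MvPolynomial.pderiv i q.1) x ^ 2) 0 (ball (0 : Space d) s) :=
        Measure.eqOn_open_of_ae_eq h3 isOpen_ball ((continuous_ev _).pow 2).continuousOn
          continuousOn_const
      exact pow_eq_zero_iff two_ne_zero |>.1 (h4 hx)
    refine Subtype.ext (eq_zero_of_ev_eq_zero isOpen_univ univ_nonempty _ fun x _ => ?_)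
    rw [ev_eq_ev_of_pderiv_eq_zero h2 x 0]
    exact pow_eq_zero_iff two_ne_zero |>.1 h0'.2

/-- The Poincaré inequality for polynomials between two balls with the same centre, with the right
scaling in `h`. -/
lemma exists_integral_ball_sub_sq_le (d m : ℕ) (R : ℝ) {s : ℝ} (hs : 0 < s) :
    ∃ C : ℝ, 0 < C ∧ ∀ q : MvPolynomial (Fin d) ℝ, q.totalDegree ≤ m →
      ∀ (c : Space d) (h : ℝ), 0 < h →
      ∫ x in ball c (h * R), (ev q x - ev q c) ^ 2 ≤
        C * h ^ 2 * ∑ i, ∫ x in ball c (h * s), ev (MvPolynomial.pderiv i q) x ^ 2 := by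
  obtain ⟨C, hC, H⟩ := exists_integral_ball_sq_le d m R hs
  refine ⟨C, hC, fun q hq c h hh => ?_⟩
  have h1 := H (rescale c h q - MvPolynomial.C (ev q c))
    ((MvPolynomial.totalDegree_sub _ _).trans (max_le ((totalDegree_rescale_le _ _ _).trans hq)
      (by simp)))
  have h2 : ∀ i, ∫ y in ball (0 : Space d) s, ev (MvPolynomial.pderiv i
      (rescale c h q - MvPolynomial.C (ev q c))) y ^ 2 =
      h ^ 2 * ((h ^ d)⁻¹ * ∫ x in ball c (h * s), ev (MvPolynomial.pderiv i q) x ^ 2) := fun i => by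
    rw [← setIntegral_ball_comp_add_smul (fun x => ev (MvPolynomial.pderiv i q) x ^ 2) c hh s,
      ← integral_const_mul]
    simp [pderiv_rescale, ev_rescale, mul_pow]
  have h3 : ∫ y in ball (0 : Space d) R, ev (rescale c h q - MvPolynomial.C (ev q c)) y ^ 2 =
      (h ^ d)⁻¹ * ∫ x in ball c (h * R), (ev q x - ev q c) ^ 2 := by
    rw [← setIntegral_ball_comp_add_smul (fun x => (ev q x - ev q c) ^ 2) c hh R]
    simp [ev_rescale]
  rw [Finset.sum_congr rfl fun i _ => h2 i, h3] at h1
  have h4 : ev (rescale c h q - MvPolynomial.C (ev q c)) (0 : Space d) = 0 := by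
    simp [ev_rescale]
  rw [h4, ← Finset.mul_sum, ← Finset.mul_sum] at h1
  have hpos : 0 < h ^ d := pow_pos hh d
  have h5 := mul_le_mul_of_nonneg_left h1 hpos.le
  rw [mul_inv_cancel_left₀ hpos.ne'] at h5
  refine h5.trans (le_of_eq ?_)
  field_simp
  ring

/-- The Poincaré inequality for polynomials with zero mean on the elements of a regular mesh. -/
lemma exists_integral_element_sq_le (hd : 0 < d) {ρ : ℝ} (hρ : 0 < ρ) (m : ℕ) :
    ∃ C : ℝ, 0 < C ∧ ∀ (Ω : Set (Space d)) (M : PolytopalMesh d Ω), M.IsRegular ρ →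
      ∀ T ∈ M.elements, ∀ q : MvPolynomial (Fin d) ℝ, q.totalDegree ≤ m → ∫ x in T, ev q x = 0 →
        ∫ x in T, ev q x ^ 2 ≤ C * diam T ^ 2 * ∫ x in T, grad q x ⬝ᵥ grad q x := by
  obtain ⟨C, hC, H⟩ := exists_integral_ball_sub_sq_le d m 2 (s := ρ ^ 2) (by positivity)
  refine ⟨C, hC, fun Ω M hM T hT q hq h0 => ?_⟩
  have hP := M.isPolytope_of_mem T hT
  have hTo := hP.isOpen
  have hTb := hP.isBounded
  have hh : 0 < diam T := diam_pos_of_isOpen hd hTo hP.1.nonempty hTb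
  obtain ⟨N, Y, hN, hN0, hTY, hY⟩ :=
    (hM.1 T hT).exists_starShapedBall hd hρ hTo hP.1.nonempty hTb
  obtain ⟨c, hc⟩ := hY ⟨0, hN0⟩
  have hI : ∀ {f : Space d → ℝ}, Continuous f → IntegrableOn f T := fun hf =>
    integrableOn_of_continuous hTb hTo.measurableSet hTb.measure_lt_top.ne hf
  have hball : ball c (diam T * ρ ^ 2) ⊆ T := fun z hz => by
    rw [mul_comm] at hz
    rw [hTY]
    exact mem_iUnion.2 ⟨_, (hc z hz).1⟩
  have hcT : c ∈ T := hball (mem_ball_self (by positivity))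
  have hTball : T ⊆ ball c (diam T * 2) := fun x hx => by
    have := dist_le_diam_of_mem hTb hx hcT
    rw [mem_ball]; linarith
  have hqc := continuous_ev q
  have hgrad : ∀ i, Continuous fun x : Space d => ev (MvPolynomial.pderiv i q) x ^ 2 := fun i =>
    (continuous_ev _).pow 2
  -- the mean value minimises the distance to constants, so that it may be replaced by `q c`
  have h1 : ∫ x in T, ev q x ^ 2 ≤ ∫ x in T, (ev q x - ev q c) ^ 2 := by
    have h2 : ∀ x, (ev q x - ev q c) ^ 2 = ev q x ^ 2 - 2 * ev q c * ev q x + ev q c ^ 2 :=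
      fun x => by ring
    simp_rw [h2]
    rw [integral_add (hI (by fun_prop)) (hI (by fun_prop)),
      integral_sub (hI (by fun_prop)) (hI (by fun_prop)), integral_const_mul, h0, mul_zero,
      sub_zero]
    exact le_add_of_nonneg_right (integral_nonneg fun x => sq_nonneg _)
  calc ∫ x in T, ev q x ^ 2 ≤ ∫ x in T, (ev q x - ev q c) ^ 2 := h1
    _ ≤ ∫ x in ball c (diam T * 2), (ev q x - ev q c) ^ 2 :=
        setIntegral_mono_set (integrableOn_ball (by fun_prop) _ _)
          (Filter.Eventually.of_forall fun x => sq_nonneg _) hTball.eventuallyLE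
    _ ≤ C * diam T ^ 2 * ∑ i, ∫ x in ball c (diam T * ρ ^ 2), ev (MvPolynomial.pderiv i q) x ^ 2 :=
        H q hq c _ hh
    _ ≤ C * diam T ^ 2 * ∑ i, ∫ x in T, ev (MvPolynomial.pderiv i q) x ^ 2 := by
        refine mul_le_mul_of_nonneg_left (Finset.sum_le_sum fun i _ => ?_) (by positivity)
        exact setIntegral_mono_set (hI (hgrad i))
          (Filter.Eventually.of_forall fun x => sq_nonneg _) hball.eventuallyLE
    _ = C * diam T ^ 2 * ∫ x in T, grad q x ⬝ᵥ grad q x := by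
        rw [← integral_finsetSum _ fun i _ => hI (hgrad i)]
        simp [dotProduct, grad, pow_two]

/-! ### The difference operators -/

/-- The `i`-th component of the polynomial vector field `K ∇ w`. -/
def fluxComp (K : Matrix (Fin d) (Fin d) ℝ) (w : MvPolynomial (Fin d) ℝ) (i : Fin d) :
    MvPolynomial (Fin d) ℝ :=
  ∑ j, MvPolynomial.C (K i j) * MvPolynomial.pderiv j w

lemma ev_fluxComp (K : Matrix (Fin d) (Fin d) ℝ) (w : MvPolynomial (Fin d) ℝ) (i : Fin d)
    (x : Space d) : ev (fluxComp K w i) x = (K *ᵥ grad w x) i := by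
  simp [fluxComp, Matrix.mulVec, dotProduct, grad]

lemma totalDegree_fluxComp_le (K : Matrix (Fin d) (Fin d) ℝ) (w : MvPolynomial (Fin d) ℝ)
    (i : Fin d) : (fluxComp K w i).totalDegree ≤ w.totalDegree - 1 := by
  refine MvPolynomial.totalDegree_finsetSum_le fun j _ => ?_
  refine (MvPolynomial.totalDegree_mul _ _).trans ?_
  rw [MvPolynomial.totalDegree_C, zero_add]
  exact totalDegree_pderiv_le w j

lemma totalDegree_divGrad_le (K : Matrix (Fin d) (Fin d) ℝ) (w : MvPolynomial (Fin d) ℝ) :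
    (divGrad K w).totalDegree ≤ w.totalDegree - 2 := by
  refine MvPolynomial.totalDegree_finsetSum_le fun i _ => ?_
  refine (totalDegree_pderiv_le _ i).trans ?_
  have := totalDegree_fluxComp_le K w i
  unfold fluxComp at this
  omega

/-- The polynomial `K ∇ w · n`. -/
def normalFlux (K : Matrix (Fin d) (Fin d) ℝ) (w : MvPolynomial (Fin d) ℝ) (n : Fin d → ℝ) :
    MvPolynomial (Fin d) ℝ :=
  ∑ i, fluxComp K w i * MvPolynomial.C (n i)

lemma ev_normalFlux (K : Matrix (Fin d) (Fin d) ℝ) (w : MvPolynomial (Fin d) ℝ) (n : Fin d → ℝ)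
    (x : Space d) : ev (normalFlux K w n) x = (K *ᵥ grad w x) ⬝ᵥ n := by
  simp [normalFlux, ev_fluxComp, dotProduct]

lemma totalDegree_normalFlux_le (K : Matrix (Fin d) (Fin d) ℝ) (w : MvPolynomial (Fin d) ℝ)
    (n : Fin d → ℝ) : (normalFlux K w n).totalDegree ≤ w.totalDegree - 1 := by
  refine MvPolynomial.totalDegree_finsetSum_le fun i _ => ?_
  refine (MvPolynomial.totalDegree_mul _ _).trans ?_
  rw [MvPolynomial.totalDegree_C, add_zero]
  exact totalDegree_fluxComp_le K w i

/-- The polynomial `K ∇ w · ∇ w`. -/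
def energyDensity (K : Matrix (Fin d) (Fin d) ℝ) (w : MvPolynomial (Fin d) ℝ) :
    MvPolynomial (Fin d) ℝ :=
  ∑ i, fluxComp K w i * MvPolynomial.pderiv i w

lemma ev_energyDensity (K : Matrix (Fin d) (Fin d) ℝ) (w : MvPolynomial (Fin d) ℝ)
    (x : Space d) : ev (energyDensity K w) x = (K *ᵥ grad w x) ⬝ᵥ grad w x := by
  simp [energyDensity, ev_fluxComp, dotProduct, grad]

lemma totalDegree_energyDensity_le (K : Matrix (Fin d) (Fin d) ℝ) (w : MvPolynomial (Fin d) ℝ) :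
    (energyDensity K w).totalDegree ≤ w.totalDegree + w.totalDegree := by
  refine MvPolynomial.totalDegree_finsetSum_le fun i _ => ?_
  refine (MvPolynomial.totalDegree_mul _ _).trans ?_
  have h1 := totalDegree_fluxComp_le K w i
  have h2 := totalDegree_pderiv_le w i
  omega

section Element

variable {Ω : Set (Space d)} (M : PolytopalMesh d Ω) {T : Set (Space d)} (hT : T ∈ M.elements)
include hT

lemma PolytopalMesh.integrableOn_element {f : Space d → ℝ} (hf : Continuous f) :
    IntegrableOn f T :=
  have hP := M.isPolytope_of_mem T hT
  integrableOn_of_continuous hP.isBounded hP.isOpen.measurableSet hP.isBounded.measure_lt_top.ne hf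

lemma PolytopalMesh.integrableOn_face {F : Set (Space d)} (hF : F ∈ M.facesOf T)
    {f : Space d → ℝ} (hf : Continuous f) : IntegrableOn f F μHE[d - 1] :=
  have h := M.facesOf_spec hT hF
  integrableOn_of_continuous h.1 h.2.1 h.2.2 hf

lemma PolytopalMesh.setIntegral_pderiv_eq (q : MvPolynomial (Fin d) ℝ) (i : Fin d) :
    ∫ x in T, ev (MvPolynomial.pderiv i q) x =
      ∑ F : M.facesOf T, outerNormal T F.1 i * ∫ x in F.1, ev q x ∂μHE[d - 1] := by
  have hP := M.isPolytope_of_mem T hT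
  have hspec := fun F (hF : F ∈ M.facesOf T) => M.facesOf_spec hT hF
  have hmem := fun F (hF : F ∈ M.facesOf T) => (M.mem_facesOf.1 hF).1
  have h := setIntegral_fderiv_eq_sum_faces (T := T) (𝓕 := M.facesOf T)
    (n := fun F => outerNormal T F) hP.isOpen hP.isBounded
    (fun F hF => M.isOuterNormal_outerNormal hT hF)
    (fun F hF => (hspec F hF).1) (fun F hF => (hspec F hF).2.1) (fun F hF => (hspec F hF).2.2)
    (fun F hF => (M.isFace_of_mem F (hmem F hF)).2.2)
    (fun F hF F' hF' => M.disjoint_faces F (hmem F hF) F' (hmem F' hF')) ?_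
    (contDiff_ev q) (e := EuclideanSpace.single i 1) (by simp)
  · simp_rw [fderiv_ev_single] at h
    rw [h, ← Finset.sum_coe_sort]
    simp [EuclideanSpace.inner_single_right]
  · rw [M.frontier_eq T hT]
    refine iUnion₂_subset fun F hF => ?_
    exact subset_biUnion_of_mem (u := fun F => closure F) (M.mem_facesOf.2 hF)

/-- Integration by parts for polynomials on a mesh element. -/
lemma PolytopalMesh.integral_mul_divGrad_add (K : Matrix (Fin d) (Fin d) ℝ)
    (a w : MvPolynomial (Fin d) ℝ) :
    (∫ x in T, ev a x * ev (divGrad K w) x) + ∫ x in T, (K *ᵥ grad w x) ⬝ᵥ grad a x =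
      ∑ F : M.facesOf T, ∫ x in F.1, ev a x *
        ((K *ᵥ grad w x) ⬝ᵥ fun i => outerNormal T F.1 i) ∂μHE[d - 1] := by
  have hc := fun p : MvPolynomial (Fin d) ℝ => continuous_ev p
  have h1 : (∫ x in T, ev a x * ev (divGrad K w) x) + ∫ x in T, (K *ᵥ grad w x) ⬝ᵥ grad a x =
      ∑ i, ∫ x in T, ev (MvPolynomial.pderiv i (a * fluxComp K w i)) x := by
    have hKg : Continuous fun x => (K *ᵥ grad w x) ⬝ᵥ grad a x :=
      (continuous_const.matrix_mulVec (continuous_grad w)).dotProduct (continuous_grad a)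
    rw [← integral_add (M.integrableOn_element hT ((hc _).fun_mul (hc _)))
        (M.integrableOn_element hT hKg),
      ← integral_finsetSum _ fun i _ => M.integrableOn_element hT (hc _)]
    refine integral_congr_ae (Filter.Eventually.of_forall fun x => ?_)
    have h2 : ev (divGrad K w) x = ∑ i, ev (MvPolynomial.pderiv i (fluxComp K w i)) x := by
      simp only [divGrad, ev_sum, fluxComp]
    simp only [h2, dotProduct, ← ev_fluxComp, MvPolynomial.pderiv_mul, ev_add, ev_mul,
      Finset.sum_add_distrib, Finset.mul_sum, grad]
    rw [add_comm]
    congr 1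
    exact Finset.sum_congr rfl fun i _ => mul_comm _ _
  rw [h1, Finset.sum_congr rfl fun i _ => M.setIntegral_pderiv_eq hT _ i, Finset.sum_comm]
  refine Finset.sum_congr rfl fun F _ => ?_
  simp_rw [← integral_const_mul]
  rw [← integral_finsetSum _ fun i _ => M.integrableOn_face hT F.2 ((hc _).const_mul _)]
  refine integral_congr_ae (Filter.Eventually.of_forall fun x => ?_)
  simp only [dotProduct, ← ev_fluxComp, Finset.mul_sum, ev_mul]
  exact Finset.sum_congr rfl fun i _ => by ring

end Element

lemma dotProduct_mulVec_comm_of_isSymm {K : Matrix (Fin d) (Fin d) ℝ} (hK : K.IsSymm)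
    (a b : Fin d → ℝ) : (K *ᵥ a) ⬝ᵥ b = (K *ᵥ b) ⬝ᵥ a := by
  rw [dotProduct_comm, Matrix.dotProduct_mulVec, ← Matrix.mulVec_transpose, hK.eq]

/-- Young's inequality for the scalar product defined by `K`. -/
lemma mul_dotProduct_mulVec_le {K : Matrix (Fin d) (Fin d) ℝ} (hK : K.IsSymm)
    (hpos : ∀ x : Fin d → ℝ, 0 ≤ (K *ᵥ x) ⬝ᵥ x) {ε : ℝ} (hε : 0 < ε) (z : ℝ) (a n : Fin d → ℝ) :
    z * ((K *ᵥ a) ⬝ᵥ n) ≤ (2 * ε)⁻¹ * (((K *ᵥ n) ⬝ᵥ n) * z * z) + ε / 2 * ((K *ᵥ a) ⬝ᵥ a) := by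
  have h1 := hpos (ε • a - z • n)
  have h2 : (K *ᵥ (ε • a - z • n)) ⬝ᵥ (ε • a - z • n) =
      ε ^ 2 * ((K *ᵥ a) ⬝ᵥ a) - 2 * ε * (z * ((K *ᵥ a) ⬝ᵥ n)) + z ^ 2 * ((K *ᵥ n) ⬝ᵥ n) := by
    simp only [Matrix.mulVec_sub, Matrix.mulVec_smul, sub_dotProduct, dotProduct_sub,
      smul_dotProduct, dotProduct_smul, smul_eq_mul, dotProduct_mulVec_comm_of_isSymm hK n a]
    ring
  rw [h2] at h1
  have h3 : z * ((K *ᵥ a) ⬝ᵥ n) = (2 * ε)⁻¹ * (2 * ε * (z * ((K *ᵥ a) ⬝ᵥ n))) := by field_simp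
  have h4 : (2 * ε)⁻¹ * (((K *ᵥ n) ⬝ᵥ n) * z * z) + ε / 2 * ((K *ᵥ a) ⬝ᵥ a) =
      (2 * ε)⁻¹ * (ε ^ 2 * ((K *ᵥ a) ⬝ᵥ a) + z ^ 2 * ((K *ᵥ n) ⬝ᵥ n)) := by field_simp; ring
  rw [h3, h4]
  exact mul_le_mul_of_nonneg_left (by linarith) (by positivity)

lemma norm_outerNormal_dotProduct {T F : Set (Space d)} {n : Space d} (h : IsOuterNormal T F n) :
    (fun i => n i) ⬝ᵥ (fun i => n i) = 1 := by
  have h1 := EuclideanSpace.real_norm_sq_eq n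
  rw [h.1] at h1
  simp only [dotProduct, ← pow_two]
  linarith

/-- The difference operators are orthogonal to the fluxes: this is the definition of the potential
reconstruction, integrated by parts. -/
lemma PolytopalMesh.integral_deltaT_mul_divGrad {k l : ℕ} (hkl : k ≤ l + 1)
    {Ω : Set (Space d)} (M : PolytopalMesh d Ω)
    {T : Set (Space d)} (hT : T ∈ M.elements) {K : Matrix (Fin d) (Fin d) ℝ} {κ : ℝ}
    (hKs : K.IsSymm) (hκ : 0 < κ) (hK : ∀ x : Fin d → ℝ, κ * (x ⬝ᵥ x) ≤ (K *ᵥ x) ⬝ᵥ x)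
    (v : LocalSpace d k l (M.facesOf T)) (w : Poly d (k + 1)) :
    ∫ x in T, ev (deltaT T (M.facesOf T) K v).1 x * ev (divGrad K w.1) x =
      ∑ F : M.facesOf T, ∫ x in F.1, ev (deltaBdry T (M.facesOf T) K v F).1 x *
        ((K *ᵥ grad w.1 x) ⬝ᵥ fun i => outerNormal T F.1 i) ∂μHE[d - 1] := by
  have hc := fun p : MvPolynomial (Fin d) ℝ => continuous_ev p
  have hw := (MvPolynomial.mem_restrictTotalDegree _ _ _).1 w.2
  set p := reconstruction T (M.facesOf T) K v with hp
  have hrec := (M.isReconstruction_reconstruction hT hκ hK v).1 w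
  rw [← hp] at hrec
  have hibp := M.integral_mul_divGrad_add hT K p.1 w.1
  have hsymm : ∫ x in T, (K *ᵥ grad p.1 x) ⬝ᵥ grad w.1 x =
      ∫ x in T, (K *ᵥ grad w.1 x) ⬝ᵥ grad p.1 x := by
    simp_rw [dotProduct_mulVec_comm_of_isSymm hKs (grad p.1 _)]
  rw [hsymm] at hrec
  have hL : ∫ x in T, ev (deltaT T (M.facesOf T) K v).1 x * ev (divGrad K w.1) x =
      (∫ x in T, ev p.1 x * ev (divGrad K w.1) x) -
        ∫ x in T, ev v.1.1 x * ev (divGrad K w.1) x := by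
    have h1 := M.isL2Proj_element hT l (f := fun x => ev p.1 x - ev v.1.1 x)
      ((hc _).sub (hc _)) ⟨divGrad K w.1, (MvPolynomial.mem_restrictTotalDegree _ _ _).2
        ((totalDegree_divGrad_le K w.1).trans (by omega))⟩
    refine h1.trans ?_
    rw [← integral_sub (M.integrableOn_element hT ((hc _).fun_mul (hc _)))
      (M.integrableOn_element hT ((hc _).fun_mul (hc _)))]
    simp_rw [sub_mul]
  have hR : ∀ F : M.facesOf T, ∫ x in F.1, ev (deltaBdry T (M.facesOf T) K v F).1 x *
        ((K *ᵥ grad w.1 x) ⬝ᵥ fun i => outerNormal T F.1 i) ∂μHE[d - 1] =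
      (∫ x in F.1, ev p.1 x * ((K *ᵥ grad w.1 x) ⬝ᵥ fun i => outerNormal T F.1 i) ∂μHE[d - 1]) -
        ∫ x in F.1, ev (v.2 F).1 x *
          ((K *ᵥ grad w.1 x) ⬝ᵥ fun i => outerNormal T F.1 i) ∂μHE[d - 1] := fun F => by
    have h1 := M.isL2Proj_face hT F.2 k (f := fun x => ev p.1 x - ev (v.2 F).1 x)
      ((hc _).sub (hc _)) ⟨normalFlux K w.1 fun i => outerNormal T F.1 i,
        (MvPolynomial.mem_restrictTotalDegree _ _ _).2
          ((totalDegree_normalFlux_le K w.1 _).trans (by omega))⟩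
    simp_rw [← ev_normalFlux]
    refine h1.trans ?_
    rw [← integral_sub (M.integrableOn_face hT F.2 ((hc _).fun_mul (hc _)))
      (M.integrableOn_face hT F.2 ((hc _).fun_mul (hc _)))]
    simp_rw [sub_mul]
  rw [hL, Finset.sum_congr rfl fun F _ => hR F, Finset.sum_sub_distrib, ← hibp]
  linarith

/-- The energy of the element difference is a boundary term. -/
lemma PolytopalMesh.energy_deltaT_eq {k l : ℕ} (hkl : k ≤ l + 1) (hlk : l ≤ k + 1)
    {Ω : Set (Space d)} (M : PolytopalMesh d Ω)
    {T : Set (Space d)} (hT : T ∈ M.elements) {K : Matrix (Fin d) (Fin d) ℝ} {κ : ℝ}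
    (hKs : K.IsSymm) (hκ : 0 < κ) (hK : ∀ x : Fin d → ℝ, κ * (x ⬝ᵥ x) ≤ (K *ᵥ x) ⬝ᵥ x)
    (v : LocalSpace d k l (M.facesOf T)) :
    ∫ x in T, (K *ᵥ grad (deltaT T (M.facesOf T) K v).1 x) ⬝ᵥ
        grad (deltaT T (M.facesOf T) K v).1 x =
      ∑ F : M.facesOf T, ∫ x in F.1,
        -(ev (deltaBdry T (M.facesOf T) K v F).1 x - ev (deltaT T (M.facesOf T) K v).1 x) *
        ((K *ᵥ grad (deltaT T (M.facesOf T) K v).1 x) ⬝ᵥ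
          fun i => outerNormal T F.1 i) ∂μHE[d - 1] := by
  have hc := fun p : MvPolynomial (Fin d) ℝ => continuous_ev p
  set δ := deltaT T (M.facesOf T) K v with hδ
  have hδdeg := (MvPolynomial.mem_restrictTotalDegree _ _ _).1 δ.2
  have h1 := M.integral_deltaT_mul_divGrad hkl hT hKs hκ hK v
    ⟨δ.1, (MvPolynomial.mem_restrictTotalDegree _ _ _).2 (hδdeg.trans hlk)⟩
  rw [← hδ] at h1
  have h2 := M.integral_mul_divGrad_add hT K δ.1 δ.1
  have h3 : ∀ F : M.facesOf T, ∫ x in F.1,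
        -(ev (deltaBdry T (M.facesOf T) K v F).1 x - ev δ.1 x) *
        ((K *ᵥ grad δ.1 x) ⬝ᵥ fun i => outerNormal T F.1 i) ∂μHE[d - 1] =
      (∫ x in F.1, ev δ.1 x * ((K *ᵥ grad δ.1 x) ⬝ᵥ fun i => outerNormal T F.1 i) ∂μHE[d - 1]) -
        ∫ x in F.1, ev (deltaBdry T (M.facesOf T) K v F).1 x *
          ((K *ᵥ grad δ.1 x) ⬝ᵥ fun i => outerNormal T F.1 i) ∂μHE[d - 1] := fun F => by
    simp_rw [← ev_normalFlux]
    rw [← integral_sub (M.integrableOn_face hT F.2 ((hc _).fun_mul (hc _)))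
      (M.integrableOn_face hT F.2 ((hc _).fun_mul (hc _)))]
    refine integral_congr_ae (Filter.Eventually.of_forall fun x => ?_)
    ring
  rw [Finset.sum_congr rfl fun F _ => h3 F, Finset.sum_sub_distrib, ← h1, ← h2]
  simp

lemma PolytopalMesh.integral_deltaT_eq_zero {k l : ℕ}
    {Ω : Set (Space d)} (M : PolytopalMesh d Ω)
    {T : Set (Space d)} (hT : T ∈ M.elements) {K : Matrix (Fin d) (Fin d) ℝ} {κ : ℝ}
    (hκ : 0 < κ) (hK : ∀ x : Fin d → ℝ, κ * (x ⬝ᵥ x) ≤ (K *ᵥ x) ⬝ᵥ x)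
    (v : LocalSpace d k l (M.facesOf T)) :
    ∫ x in T, ev (deltaT T (M.facesOf T) K v).1 x = 0 := by
  have h1 := M.isL2Proj_element hT l
    (f := fun x => ev (reconstruction T (M.facesOf T) K v).1 x - ev v.1.1 x)
    ((continuous_ev _).sub (continuous_ev _))
    ⟨MvPolynomial.C 1, (MvPolynomial.mem_restrictTotalDegree _ _ _).2 (by simp)⟩
  have h2 := (M.isReconstruction_reconstruction hT hκ hK v).2
  simp only [ev_C, mul_one] at h1
  refine h1.trans ?_
  simp_rw [← neg_sub (ev v.1.1 _)]
  rw [integral_neg, h2, neg_zero]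

/-! ### The comparison of the stabilisations -/

/-- The stabilisation estimate on one element, from a discrete trace inequality of constant `Ct` and
a Poincaré inequality of constant `Cp` on that element. -/
lemma PolytopalMesh.sGradMin_le_mul_sBdry {k l : ℕ} (hkl : k ≤ l + 1) (hlk : l ≤ k + 1)
    {Ω : Set (Space d)} (M : PolytopalMesh d Ω)
    {T : Set (Space d)} (hT : T ∈ M.elements) (hh : 0 < diam T)
    {K : Matrix (Fin d) (Fin d) ℝ} {κ : ℝ}
    (hKs : K.IsSymm) (hκ : 0 < κ) (hK : ∀ x : Fin d → ℝ, κ * (x ⬝ᵥ x) ≤ (K *ᵥ x) ⬝ᵥ x)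
    {Ct Cp : ℝ} (hCt : 0 < Ct) (hCp : 0 < Cp)
    (htr : ∀ q : MvPolynomial (Fin d) ℝ, q.totalDegree ≤ l + l →
      ∑ F ∈ M.facesOf T, ∫ x in F, |ev q x| ∂μHE[d - 1] ≤
        Ct * (diam T)⁻¹ * ∫ x in T, |ev q x|)
    (hpo : ∀ q : MvPolynomial (Fin d) ℝ, q.totalDegree ≤ l → ∫ x in T, ev q x = 0 →
      ∫ x in T, ev q x ^ 2 ≤ Cp * diam T ^ 2 * ∫ x in T, grad q x ⬝ᵥ grad q x)
    (v : LocalSpace d k l (M.facesOf T)) :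
    sGradMin T (M.facesOf T) K κ v v ≤
      (Ct + 2 + 2 * Ct ^ 2 * Cp) * sBdry T (M.facesOf T) K v v := by
  have hc := fun p : MvPolynomial (Fin d) ℝ => continuous_ev p
  have hsq : ∀ x : Fin d → ℝ, 0 ≤ x ⬝ᵥ x := fun x =>
    Finset.sum_nonneg fun i _ => mul_self_nonneg _
  have hKpos : ∀ x : Fin d → ℝ, 0 ≤ (K *ᵥ x) ⬝ᵥ x := fun x =>
    (mul_nonneg hκ.le (hsq x)).trans (hK x)
  have hE := M.energy_deltaT_eq hkl hlk hT hKs hκ hK v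
  have hmean := M.integral_deltaT_eq_zero hT hκ hK v
  unfold sGradMin sBdry
  set δ := deltaT T (M.facesOf T) K v with hδ
  set b := deltaBdry T (M.facesOf T) K v with hb
  have hδdeg := (MvPolynomial.mem_restrictTotalDegree _ _ _).1 δ.2
  set h := diam T with hhdef
  let n : M.facesOf T → Fin d → ℝ := fun F i => outerNormal T F.1 i
  have hn : ∀ F : M.facesOf T, κ ≤ (K *ᵥ n F) ⬝ᵥ n F := fun F => by
    have h1 := hK (n F)
    rwa [show n F ⬝ᵥ n F = 1 from
      norm_outerNormal_dotProduct (M.isOuterNormal_outerNormal hT F.2), mul_one] at h1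
  set S := ∑ F : M.facesOf T, ∫ x in F.1, ((K *ᵥ n F) ⬝ᵥ n F) * (ev (b F).1 x - ev δ.1 x) *
    (ev (b F).1 x - ev δ.1 x) ∂μHE[d - 1] with hS
  set E := ∫ x in T, (K *ᵥ grad δ.1 x) ⬝ᵥ grad δ.1 x with hEdef
  set G := ∫ x in T, grad δ.1 x ⬝ᵥ grad δ.1 x with hGdef
  set B := ∑ F : M.facesOf T, ∫ x in F.1, ev (b F).1 x * ev (b F).1 x ∂μHE[d - 1] with hB
  have hgg : Continuous fun x => grad δ.1 x ⬝ᵥ grad δ.1 x :=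
    (continuous_grad _).dotProduct (continuous_grad _)
  -- the energy of `δ` on the faces
  have htrE : ∑ F : M.facesOf T, ∫ x in F.1, ev (energyDensity K δ.1) x ∂μHE[d - 1] ≤
      Ct * h⁻¹ * E := by
    have h1 := htr (energyDensity K δ.1)
      ((totalDegree_energyDensity_le K δ.1).trans (add_le_add hδdeg hδdeg))
    have h2 : ∀ x, |ev (energyDensity K δ.1) x| = ev (energyDensity K δ.1) x := fun x =>
      abs_of_nonneg (by rw [ev_energyDensity]; exact hKpos _)
    simp_rw [h2] at h1
    rw [← Finset.sum_coe_sort] at h1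
    refine h1.trans (le_of_eq ?_)
    simp_rw [ev_energyDensity]
    rfl
  -- absorption of the energy, with the parameter that leaves half of it on the left-hand side
  have hES : E ≤ Ct * (h⁻¹ * S) := by
    have hε : 0 < h / Ct := by positivity
    have h1 : E ≤ (2 * (h / Ct))⁻¹ * S + h / Ct / 2 *
        ∑ F : M.facesOf T, ∫ x in F.1, ev (energyDensity K δ.1) x ∂μHE[d - 1] := by
      rw [hE, hS, Finset.mul_sum, Finset.mul_sum, ← Finset.sum_add_distrib]
      refine Finset.sum_le_sum fun F _ => ?_
      have i1 := M.integrableOn_face hT F.2 (f := fun x => (2 * (h / Ct))⁻¹ *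
        (((K *ᵥ n F) ⬝ᵥ n F) * (ev (b F).1 x - ev δ.1 x) * (ev (b F).1 x - ev δ.1 x)))
        (by have h1 := hc (b F).1; have h2 := hc δ.1; fun_prop)
      have i2 := M.integrableOn_face hT F.2 ((hc (energyDensity K δ.1)).const_mul (h / Ct / 2))
      have i3 := M.integrableOn_face hT F.2 (f := fun x => -(ev (b F).1 x - ev δ.1 x) *
        ((K *ᵥ grad δ.1 x) ⬝ᵥ n F)) (by
          simp_rw [← ev_normalFlux]
          exact (((hc _).sub (hc _)).neg).mul (hc _))
      rw [← integral_const_mul, ← integral_const_mul, ← integral_add i1 i2]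
      refine integral_mono i3 (i1.add i2) fun x => ?_
      have h3 := mul_dotProduct_mulVec_le hKs hKpos hε (-(ev (b F).1 x - ev δ.1 x))
        (grad δ.1 x) (n F)
      simp only [ev_energyDensity]
      refine h3.trans (le_of_eq ?_)
      ring
    have h2 : h / Ct / 2 * (Ct * h⁻¹ * E) = E / 2 := by field_simp
    have h3 := mul_le_mul_of_nonneg_left htrE (by positivity : (0:ℝ) ≤ h / Ct / 2)
    have h4 : (2 * (h / Ct))⁻¹ * S = Ct * (h⁻¹ * S) / 2 := by field_simp
    rw [h2] at h3
    rw [h4] at h1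
    linarith
  have hGE : κ * G ≤ E := by
    rw [hGdef, hEdef, ← integral_const_mul]
    refine integral_mono (M.integrableOn_element hT (hgg.const_mul κ)) ?_ fun x => hK _
    simp_rw [← ev_energyDensity]
    exact M.integrableOn_element hT (hc _)
  -- the trace of `δ` on the faces
  have htrδ : ∑ F : M.facesOf T, ∫ x in F.1, ev δ.1 x * ev δ.1 x ∂μHE[d - 1] ≤
      Ct * h⁻¹ * (Cp * h ^ 2 * G) := by
    have h1 := htr (δ.1 * δ.1)
      ((MvPolynomial.totalDegree_mul _ _).trans (add_le_add hδdeg hδdeg))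
    have h2 : ∀ x, |ev (δ.1 * δ.1) x| = ev δ.1 x * ev δ.1 x := fun x => by
      rw [ev_mul, abs_mul_self]
    simp_rw [h2] at h1
    rw [← Finset.sum_coe_sort] at h1
    refine h1.trans (mul_le_mul_of_nonneg_left ?_ (by positivity))
    simp_rw [← pow_two]
    exact hpo δ.1 hδdeg hmean
  have hBS : κ * B ≤ 2 * S +
      2 * κ * ∑ F : M.facesOf T, ∫ x in F.1, ev δ.1 x * ev δ.1 x ∂μHE[d - 1] := by
    rw [hB, hS, Finset.mul_sum, Finset.mul_sum, Finset.mul_sum, ← Finset.sum_add_distrib]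
    refine Finset.sum_le_sum fun F _ => ?_
    have c1 := hc (b F).1
    have c2 := hc δ.1
    have i1 := M.integrableOn_face hT F.2 (f := fun x => 2 *
      (((K *ᵥ n F) ⬝ᵥ n F) * (ev (b F).1 x - ev δ.1 x) * (ev (b F).1 x - ev δ.1 x)))
      (by fun_prop)
    have i2 := M.integrableOn_face hT F.2 (f := fun x => 2 * κ * (ev δ.1 x * ev δ.1 x))
      (by fun_prop)
    rw [← integral_const_mul, ← integral_const_mul, ← integral_const_mul, ← integral_add i1 i2]
    refine integral_mono (M.integrableOn_face hT F.2 (by fun_prop)) (i1.add i2) fun x => ?_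
    beta_reduce
    have h1 := mul_le_mul_of_nonneg_right (hn F) (mul_self_nonneg (ev (b F).1 x - ev δ.1 x))
    have h2 := mul_nonneg hκ.le (mul_self_nonneg (ev (b F).1 x - 2 * ev δ.1 x))
    nlinarith
  have hh' : 0 < h⁻¹ := inv_pos.2 hh
  have hfin : κ * (h⁻¹ * B) ≤ 2 * (h⁻¹ * S) + 2 * Ct * Cp * (Ct * (h⁻¹ * S)) := by
    have h1 := mul_le_mul_of_nonneg_left hBS hh'.le
    have h2 := mul_le_mul_of_nonneg_left htrδ (by positivity : 0 ≤ h⁻¹ * (2 * κ))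
    have h3 : h⁻¹ * (2 * κ) * (Ct * h⁻¹ * (Cp * h ^ 2 * G)) = 2 * Ct * Cp * (κ * G) := by
      field_simp
    have h4 := mul_le_mul_of_nonneg_left (hGE.trans hES) (by positivity : 0 ≤ 2 * Ct * Cp)
    rw [h3] at h2
    linarith
  calc κ * (G + h⁻¹ * B) = κ * G + κ * (h⁻¹ * B) := by ring
    _ ≤ Ct * (h⁻¹ * S) + (2 * (h⁻¹ * S) + 2 * Ct * Cp * (Ct * (h⁻¹ * S))) :=
        add_le_add (hGE.trans hES) hfin
    _ = (Ct + 2 + 2 * Ct ^ 2 * Cp) * (h⁻¹ * S) := by ring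

end HHO

end

theorem mainTheorem6 (d : ℕ) (hd : 2 ≤ d) (Ω : Set (HHO.Space d)) (hΩ : HHO.IsPolytope Ω)
    (ρ : ℝ) (hρ : 0 < ρ) (k l : ℕ) (hkl : k ≤ l + 1) (hlk : l ≤ k + 1) :
    ∃ C : ℝ, 0 < C ∧
      ∀ M : HHO.PolytopalMesh d Ω, M.IsRegular ρ →
      ∀ T ∈ M.elements,
      ∀ (K : Matrix (Fin d) (Fin d) ℝ) (κ : ℝ), K.IsSymm → 0 < κ →
        (∀ x : Fin d → ℝ, κ * (x ⬝ᵥ x) ≤ (K *ᵥ x) ⬝ᵥ x) →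
      ∀ v : HHO.LocalSpace d k l (M.facesOf T),
        HHO.sGradMin T (M.facesOf T) K κ v v ≤ C * HHO.sBdry T (M.facesOf T) K v v := by
  have hd0 : 0 < d := by omega
  obtain ⟨Ct, hCt, htr⟩ := HHO.exists_sum_integral_faces_le hd0 hρ (l + l)
  obtain ⟨Cp, hCp, hpo⟩ := HHO.exists_integral_element_sq_le hd0 hρ l
  refine ⟨Ct + 2 + 2 * Ct ^ 2 * Cp, by positivity, fun M hM T hT K κ hKs hκ hK v => ?_⟩
  have hP := M.isPolytope_of_mem T hT
  have hh := HHO.diam_pos_of_isOpen hd0 hP.isOpen hP.1.nonempty hP.isBounded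
  exact M.sGradMin_le_mul_sBdry hkl hlk hT hh hKs hκ hK hCt hCp (htr Ω M hM T hT)
    (hpo Ω M hM T hT) v
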